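/- For a field $F$ let $K_*^{MW}(F)=\bigoplus_{n\in\mathbf Z}K_n^{MW}(F)$ be its Milnor–Witt K-theory: the graded associative $\mathbf Z$-algebra generated by symbols $[a]$ ($a\in F^\times$) of degree $1$ and an element $\eta$ of degree $-1$, subject to $[a][1-a]=0$ for $a\neq 0,1$; $[ab]=[a]+[b]+\eta[a][b]$; $\eta[a]=[a]\eta$; and $(2+\eta[-1])\eta=0$. Put $\langle a\rangle=1+\eta[a]$. For a field $k$ let $GW(k)$ be the Grothendieck–Witt group of nondegenerate symmetric bilinear forms over $k$. For every prime $p$ choose a uniformizer $\pi_p\in\mathbf Q$ of the $p$-adic valuation, and let $\partial_p=\partial_p^{\pi_p}:K_n^{MW}(\mathbf Q)\to K_{n-1}^{MW}(\mathbf F_p)$ be the corresponding residue map, i.e. the unique family of homomorphisms that commutes with multiplication by $\eta$ and satisfies $\partial_p([\pi_p,u_1,\dots,u_m])=[\bar u_1,\dots,\bar u_m]$ and $\partial_p([u_1,\dots,u_m])=0$ for $p$-adic units $u_i$. Let $\partial=(\partial_p)_p$ be the total residue map. **Proposition 2.4.** Let $n\in\mathbf Z$. 1. If $n\neq 0$,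 there is an isomorphism of abelian groups $$K_n^{MW}(\mathbf Q)\;\cong\;\mathbf Z\oplus\bigoplus_{p}K_{n-1}^{MW}(\mathbf F_p)$$ whose component in $\bigoplus_p K_{n-1}^{MW}(\mathbf F_p)$ is $\partial$. For $n=0$ there is an isomorphism $$K_0^{MW}(\mathbf Q)\;\cong\;\mathbf Z\oplus\mathbf Z\oplus\bigoplus_{p}K_{-1}^{MW}(\mathbf F_p)$$ whose component in $\bigoplus_p K_{-1}^{MW}(\mathbf F_p)$ is $\partial$. 2. There are isomorphisms $K_0^{MW}(\mathbf F_p)\cong GW(\mathbf F_p)$, sending $\langle u\rangle$ to the class of the form $(x,y)\mapsto uxy$, and $K_1^{MW}(\mathbf F_p)\cong\mathbf F_p^\times$, sending $[u]$ to $u$; there are isomorphisms $$K_1^{MW}(\mathbf Q)\cong\mathbf Z\oplus\bigoplus_pGW(\mathbf F_p),\qquad K_2^{MW}(\mathbf Q)\cong\mathbf Z\oplus\bigoplus_p\mathbf F_p^\times$$ whose components in the direct sums over $p$ are $\partial$ followed by these identifications. 3. $K_n^{MW}(\mathbf Q)\cong\mathbf Z$ for all $n\ge 3$. -/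

import Mathlib

open scoped DirectSum

namespace MilnorWitt

/-- Generators of Milnor-Witt K-theory: `η` and one symbol `[a]` for each unit `a`. -/
inductive Gen (F : Type*) [Field F]
  | eta : Gen F
  | sym (a : Fˣ) : Gen F

/-- The degree of a generator: `-1` for `η` and `+1` for `[a]`. -/
def Gen.degree {F : Type*} [Field F] : Gen F → ℤ
  | .eta => -1
  | .sym _ => 1

/-- The defining relations, imposed on the free associative `ℤ`-algebra on the generators. -/
inductive Rel (F : Type*) [Field F] : FreeAlgebra ℤ (Gen F) → FreeAlgebra ℤ (Gen F) → Prop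
  | steinberg (a b : Fˣ) (h : (a : F) + b = 1) :
      Rel F (FreeAlgebra.ι ℤ (Gen.sym a) * FreeAlgebra.ι ℤ (Gen.sym b)) 0
  | mul (a b : Fˣ) :
      Rel F (FreeAlgebra.ι ℤ (Gen.sym (a * b)))
        (FreeAlgebra.ι ℤ (Gen.sym a) + FreeAlgebra.ι ℤ (Gen.sym b)
          + FreeAlgebra.ι ℤ Gen.eta * FreeAlgebra.ι ℤ (Gen.sym a) * FreeAlgebra.ι ℤ (Gen.sym b))
  | comm (a : Fˣ) :
      Rel F (FreeAlgebra.ι ℤ Gen.eta * FreeAlgebra.ι ℤ (Gen.sym a))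
        (FreeAlgebra.ι ℤ (Gen.sym a) * FreeAlgebra.ι ℤ Gen.eta)
  | eta :
      Rel F ((2 + FreeAlgebra.ι ℤ Gen.eta * FreeAlgebra.ι ℤ (Gen.sym (-1)))
        * FreeAlgebra.ι ℤ Gen.eta) 0

/-- The Milnor-Witt K-theory ring `K^MW_*(F)` (all degrees together). -/
def KMW (F : Type*) [Field F] := RingQuot (Rel F)

noncomputable instance (F : Type*) [Field F] : Ring (KMW F) :=
  inferInstanceAs (Ring (RingQuot (Rel F)))

namespace KMW

section Basic

variable {F : Type*} [Field F]

variable (F) in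
/-- The quotient map from the free algebra. -/
noncomputable def mk : FreeAlgebra ℤ (Gen F) →+* KMW F := RingQuot.mkRingHom (Rel F)

theorem mk_rel {x y : FreeAlgebra ℤ (Gen F)} (h : Rel F x y) : mk F x = mk F y :=
  RingQuot.mkRingHom_rel h

/-- The class of a generator in `K^MW_*(F)`. -/
noncomputable def gen (g : Gen F) : KMW F := mk F (FreeAlgebra.ι ℤ g)

/-- The element `η` of degree `-1`. -/
noncomputable def eta : KMW F := gen Gen.eta

/-- The symbol `[a]` of degree `1`. -/
noncomputable def sym (a : Fˣ) : KMW F := gen (Gen.sym a)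

/-- The element `⟨a⟩ = 1 + η[a]` of degree `0`. -/
noncomputable def angle (a : Fˣ) : KMW F := 1 + eta * sym a

variable (F) in
/-- The graded piece `K^MW_n(F)`: the additive span of all products of generators of total
degree `n`. -/
noncomputable def piece (n : ℤ) : AddSubgroup (KMW F) :=
  AddSubgroup.closure
    {x | ∃ l : List (Gen F), (l.map Gen.degree).sum = n ∧ x = (l.map gen).prod}

theorem steinberg (a b : Fˣ) (h : (a : F) + b = 1) : sym a * sym b = 0 := by
  have := mk_rel (Rel.steinberg a b h)
  rw [map_mul, map_zero] at this; exact this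

theorem sym_mul' (a b : Fˣ) : sym (a * b) = sym a + sym b + eta * sym a * sym b := by
  have := mk_rel (Rel.mul a b)
  simp only [map_mul, map_add] at this; exact this

theorem eta_sym (a : Fˣ) : eta * sym a = sym a * eta := by
  have := mk_rel (Rel.comm a)
  simp only [map_mul] at this; exact this

theorem eta_rel : (2 + eta * sym (-1 : Fˣ)) * eta = 0 := by
  have := mk_rel (Rel.eta (F := F))
  simp only [map_mul, map_add, map_zero, map_ofNat] at this; exact this

theorem induction {P : KMW F → Prop} (hint : ∀ m : ℤ, P m) (hgen : ∀ g, P (gen g))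
    (hadd : ∀ x y, P x → P y → P (x + y)) (hmul : ∀ x y, P x → P y → P (x * y)) (x : KMW F) :
    P x := by
  obtain ⟨y, rfl⟩ : ∃ y, mk F y = x := RingQuot.mkRingHom_surjective (Rel F) x
  induction y using FreeAlgebra.induction with
  | grade0 m =>
    have : mk F (algebraMap ℤ (FreeAlgebra ℤ (Gen F)) m) = ((m : ℤ) : KMW F) := by simp
    rw [this]; exact hint m
  | grade1 g => exact hgen g
  | mul a b ha hb => rw [map_mul]; exact hmul _ _ ha hb
  | add a b ha hb => rw [map_add]; exact hadd _ _ ha hb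

theorem central_of {z : KMW F} (h₁ : z * eta = eta * z) (h₂ : ∀ a, z * sym a = sym a * z)
    (x : KMW F) : z * x = x * z := by
  induction x using KMW.induction with
  | hint m => exact (Int.cast_commute m z).symm.eq
  | hgen g => cases g with
    | eta => exact h₁
    | sym a => exact h₂ a
  | hadd x y hx hy => rw [mul_add, add_mul, hx, hy]
  | hmul x y hx hy => rw [← mul_assoc, hx, mul_assoc, hy, mul_assoc]

theorem eta_comm (x : KMW F) : eta * x = x * eta := central_of rfl eta_sym x

theorem eta_sym_sym (a b : Fˣ) : eta * sym a * sym b = eta * sym b * sym a := by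
  have h := sym_mul' a b
  rw [mul_comm a b, sym_mul', add_comm (sym b)] at h
  exact (add_left_cancel h).symm

theorem angle_comm (a : Fˣ) (x : KMW F) : angle a * x = x * angle a := by
  apply central_of
  · rw [angle, ← eta_comm]
  · intro b
    rw [angle, add_mul, mul_add, one_mul, mul_one, eta_sym_sym, ← mul_assoc (sym b), ← eta_comm]

theorem sym_mul (a b : Fˣ) : sym (a * b) = sym a + angle a * sym b := by
  rw [sym_mul', angle, add_mul, one_mul, add_assoc]

theorem eta_mul_sym (a : Fˣ) : eta * sym a = angle a - 1 := by rw [angle]; abel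

theorem angle_mul (a b : Fˣ) : angle (a * b) = angle a * angle b := by
  rw [angle, sym_mul, mul_add, ← mul_assoc, eta_comm (angle a), mul_assoc, eta_mul_sym,
    eta_mul_sym, mul_sub, mul_one]
  abel

theorem angle_one_sym_one : angle (1 : Fˣ) * sym 1 = 0 := by
  have h := sym_mul (1 : Fˣ) 1
  rw [mul_one] at h
  exact left_eq_add.mp h

theorem angle_one : angle (1 : Fˣ) = 1 := by
  have h1 := angle_mul (1 : Fˣ) 1
  rw [mul_one] at h1
  have h2 : (2 + (angle (-1 : Fˣ) - 1)) * (angle (1 : Fˣ) - 1) = 0 := by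
    rw [← eta_mul_sym, ← eta_mul_sym, ← mul_assoc, eta_rel, zero_mul]
  have h3 := congrArg (fun x => angle (-1 : Fˣ) * x) h2
  have h4 : angle (-1 : Fˣ) * angle 1 = angle (-1) := by rw [← angle_mul, mul_one]
  have h5 : (2 : KMW F) + (angle (-1 : Fˣ) - 1) = 1 + angle (-1) := by
    rw [← one_add_one_eq_two]; abel
  rw [h5, add_mul, mul_sub, mul_sub, h4, mul_one, mul_one, one_mul, sub_self, add_zero] at h2
  exact sub_eq_zero.mp h2

theorem sym_one : sym (1 : Fˣ) = 0 := by
  have := angle_one_sym_one (F := F)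
  rwa [angle_one, one_mul] at this

theorem sym_inv (a : Fˣ) : sym a = -(angle a * sym a⁻¹) := by
  have := sym_mul a a⁻¹
  rw [mul_inv_cancel, sym_one] at this
  exact eq_neg_of_add_eq_zero_left this.symm

theorem sym_neg_self (a : Fˣ) : sym a * sym (-a) = 0 := by
  by_cases ha : a = 1
  · rw [ha, sym_one, zero_mul]
  have ha0 : (a : F) ≠ 0 := a.ne_zero
  have ha1 : (a : F) ≠ 1 := fun h => ha (Units.ext h)
  have h1 : (1 : F) - a ≠ 0 := sub_ne_zero.mpr (Ne.symm ha1)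
  have h2 : (1 : F) - (a : F)⁻¹ ≠ 0 := by
    intro h
    apply ha1
    have := sub_eq_zero.mp h
    field_simp at this
    exact this
  set b : Fˣ := Units.mk0 _ h1
  set c : Fˣ := Units.mk0 _ h2
  have hab : sym a * sym b = 0 := steinberg a b (by simp [b])
  have hac : sym a⁻¹ * sym c = 0 := steinberg a⁻¹ c (by simp [c])
  have hbc : -a = b * c⁻¹ := by
    rw [eq_mul_inv_iff_mul_eq]
    ext
    simp only [Units.val_mul, Units.val_neg, b, c, Units.val_mk0]
    field_simp
    ring
  have hc : sym a * sym c = 0 := by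
    rw [sym_inv a, neg_mul, mul_assoc, hac, mul_zero, neg_zero]
  have hc' : sym a * sym c⁻¹ = 0 := by
    rw [sym_inv c⁻¹, inv_inv, mul_neg, ← mul_assoc, ← angle_comm, mul_assoc, hc, mul_zero,
      neg_zero]
  rw [hbc, sym_mul, mul_add, hab, zero_add, ← mul_assoc, ← angle_comm, mul_assoc, hc', mul_zero]

theorem sym_neg_self' (a : Fˣ) : sym (-a) * sym a = 0 := by
  simpa using sym_neg_self (-a)

theorem sym_neg (a : Fˣ) : sym (-a) = sym (-1) + angle (-1) * sym a := by
  rw [← sym_mul, neg_one_mul]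

theorem angle_neg_one_sq : angle (-1 : Fˣ) * angle (-1) = 1 := by
  rw [← angle_mul, neg_mul_neg, one_mul, angle_one]

theorem sym_neg_one_comm (a : Fˣ) : sym a * sym (-1) = sym (-1) * sym a := by
  have h1 := sym_neg_self a
  have h2 := sym_neg_self' a
  rw [sym_neg, mul_add, ← mul_assoc, ← angle_comm, mul_assoc] at h1
  rw [sym_neg, add_mul, mul_assoc] at h2
  exact add_right_cancel (h1.trans h2.symm)

theorem angle_neg_one_sym : angle (-1 : Fˣ) * sym (-1) = -sym (-1) := by
  have h := sym_neg (-1 : Fˣ)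
  rw [neg_neg, sym_one] at h
  exact (neg_eq_of_add_eq_zero_right h.symm).symm

theorem angle_neg_one_eta : angle (-1 : Fˣ) * eta = -eta := by
  have h := eta_rel (F := F)
  rw [eta_mul_sym, ← one_add_one_eq_two] at h
  have h2 : (1 : KMW F) + 1 + (angle (-1) - 1) = 1 + angle (-1) := by abel
  rw [h2, add_mul, one_mul] at h
  exact (neg_eq_of_add_eq_zero_right h).symm

theorem angle_sq (a : Fˣ) : angle (a * a) = 1 := by
  have h1 := sym_neg_self a
  rw [sym_neg, mul_add, ← mul_assoc, ← angle_comm, mul_assoc] at h1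
  have h2 : eta * (sym a * sym a) = eta * (sym (-1) * sym a) := by
    have := congrArg (fun x => eta * x) h1
    simp only [mul_add, mul_zero] at this
    rw [← mul_assoc eta (angle (-1)), eta_comm (angle (-1)), angle_neg_one_eta, neg_mul] at this
    rw [← sym_neg_one_comm]
    exact (sub_eq_zero.mp (by rw [sub_eq_add_neg]; exact this)).symm
  have h3 : eta * sym (a * a) = 0 := by
    rw [sym_mul', mul_assoc eta (sym a), h2, ← mul_assoc, ← two_mul, ← add_mul, ← mul_assoc,
      eta_comm, eta_rel, zero_mul]
  rw [angle, h3, add_zero]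

theorem angle_angle_neg (a : Fˣ) : angle a * angle (-a) = angle (-1) := by
  rw [← angle_mul, ← neg_one_mul a, mul_left_comm, angle_mul, angle_sq, mul_one]

theorem angle_sym_neg (a : Fˣ) : angle a * sym (-a) = sym (-a) := by
  rw [angle, add_mul, one_mul, mul_assoc, sym_neg_self, mul_zero, add_zero]

theorem angle_neg_sym (a : Fˣ) : angle (-a) * sym a = sym a := by
  simpa using angle_sym_neg (-a)

/-- The element `ε = -⟨-1⟩` of degree `0`. -/
noncomputable def eps : KMW F := -angle (-1)

theorem eps_comm (x : KMW F) : eps * x = x * eps := by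
  rw [eps, neg_mul, mul_neg, angle_comm]

theorem eps_eta : eps * eta = (eta : KMW F) := by rw [eps, neg_mul, angle_neg_one_eta, neg_neg]

theorem eps_eps : eps * eps = (1 : KMW F) := by rw [eps, neg_mul_neg, angle_neg_one_sq]

theorem eps_sym : eps * sym (-1 : Fˣ) = sym (-1) := by
  rw [eps, neg_mul, angle_neg_one_sym, neg_neg]

variable (F) in
/-- The element `n_ε` of degree `0`: it is `(n/2)(1 + ⟨-1⟩)` for even `n` and
`((n-1)/2)(1 + ⟨-1⟩) + 1` for odd `n`, so `n_ε = 1 + ⟨-1⟩ + 1 + ⟨-1⟩ + ⋯` (`n` summands) for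
`n ≥ 0`. -/
noncomputable def epsInt (n : ℤ) : KMW F :=
  ((n / 2 : ℤ) : KMW F) * (1 + angle (-1)) + ((n % 2 : ℤ) : KMW F)

theorem epsInt_comm (n : ℤ) (x : KMW F) : epsInt F n * x = x * epsInt F n := by
  have h : Commute (1 + angle (-1)) x := (Commute.one_left x).add_left (angle_comm (-1) x)
  exact (((Int.cast_commute (n / 2) x).mul_left h).add_left (Int.cast_commute (n % 2) x)).eq

theorem epsInt_zero : epsInt F 0 = 0 := by simp [epsInt]

theorem epsInt_one : epsInt F 1 = 1 := by simp [epsInt]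

theorem epsInt_even (k : ℤ) : epsInt F (2 * k) = (k : KMW F) * (1 + angle (-1)) := by
  simp [epsInt]

theorem epsInt_odd (k : ℤ) : epsInt F (2 * k + 1) = (k : KMW F) * (1 + angle (-1)) + 1 := by
  have h1 : (2 * k + 1) / 2 = k := by omega
  have h2 : (2 * k + 1) % 2 = 1 := by omega
  rw [epsInt, h1, h2, Int.cast_one]

theorem hyp_mul : (1 + angle (-1 : Fˣ)) * (angle (-1) - 1) = 0 := by
  rw [add_mul, one_mul, mul_sub, angle_neg_one_sq, mul_one]; abel

theorem hyp_sym : (1 + angle (-1 : Fˣ)) * sym (-1) = 0 := by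
  rw [add_mul, one_mul, angle_neg_one_sym]; abel

theorem epsInt_add (n m : ℤ) : epsInt F (n + m)
    = epsInt F n + epsInt F m + epsInt F n * epsInt F m * (angle (-1) - 1) := by
  have hz (k : ℤ) : ((k : KMW F) * (1 + angle (-1))) * (angle (-1) - 1) = 0 := by
    rw [mul_assoc, hyp_mul, mul_zero]
  rcases Int.even_or_odd' n with ⟨k, rfl | rfl⟩ <;> rcases Int.even_or_odd' m with ⟨l, rfl | rfl⟩
  · rw [show 2 * k + 2 * l = 2 * (k + l) by ring, epsInt_even, epsInt_even, epsInt_even,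
      mul_assoc _ _ (angle (-1) - 1), hz, Int.cast_add, add_mul, mul_zero, add_zero]
  · rw [show 2 * k + (2 * l + 1) = 2 * (k + l) + 1 by ring, epsInt_even, epsInt_odd, epsInt_odd,
      mul_assoc _ _ (angle (-1) - 1), add_mul _ _ (angle (-1) - 1), hz, zero_add, one_mul, hz,
      Int.cast_add, add_mul, add_zero, add_assoc]
  · rw [show 2 * k + 1 + 2 * l = 2 * (k + l) + 1 by ring, epsInt_even, epsInt_odd, epsInt_odd,
      mul_assoc _ _ (angle (-1) - 1), hz, Int.cast_add, add_mul, mul_zero, add_zero]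
    abel
  · rw [show 2 * k + 1 + (2 * l + 1) = 2 * (k + l + 1) by ring, epsInt_even, epsInt_odd,
      epsInt_odd, mul_assoc _ _ (angle (-1) - 1), add_mul _ _ (angle (-1) - 1), hz, zero_add,
      one_mul, add_mul _ _ (angle (-1) - 1), hz, zero_add, one_mul]
    push_cast
    rw [add_mul, add_mul, one_mul]
    abel

theorem epsInt_sym (n : ℤ) : epsInt F n * (epsInt F n * sym (-1)) = epsInt F n * sym (-1) := by
  have hz (k : ℤ) : ((k : KMW F) * (1 + angle (-1))) * sym (-1) = 0 := by
    rw [mul_assoc, hyp_sym, mul_zero]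
  rcases Int.even_or_odd' n with ⟨k, rfl | rfl⟩
  · rw [epsInt_even, hz, mul_zero]
  · rw [epsInt_odd, add_mul _ _ (sym (-1)), hz, zero_add, one_mul, add_mul, hz, zero_add, one_mul]

end Basic
section Residue

variable {F k : Type*} [Field F] [Field k]

/-- A `ℤ`-valued order function on `Fˣ` together with the residue in `k` of the unit part
`a / π ^ ord a` of each `a`, for a discrete valuation with a chosen uniformizer `π`. -/
structure UnitPart (F k : Type*) [Field F] [Field k] where
  ord : Fˣ → ℤ
  res : Fˣ → kˣ
  ord_mul : ∀ a b, ord (a * b) = ord a + ord b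
  res_mul : ∀ a b, res (a * b) = res a * res b
  ord_neg_one : ord (-1) = 0
  res_neg_one : res (-1) = -1
  add_eq_one : ∀ a b : Fˣ, (a : F) + b = 1 →
    (ord a = 0 ∧ res a = 1) ∨ (ord b = 0 ∧ res b = 1) ∨
    (ord a = 0 ∧ ord b = 0 ∧ (res a : k) + res b = 1) ∨
    (ord a = ord b ∧ res b = -res a)

/-- The image of a generator under `Θ(x) = s(x) + ξ ∂(x)`, where the ring `K^MW_*(k)[ξ]` with
`ξ² = ξ[-1]` and `[u] ξ = ε ξ [u]`, a free right module with basis `1, ξ`, is written in terms of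
`2 × 2` matrices describing left multiplication in this basis. Here `[a]`, for `a = π ^ n u`, is
sent to `[u] + ξ n_ε ⟨u⟩`, and `η` is sent to `η`. -/
noncomputable def thetaGen (d : UnitPart F k) : Gen F → Matrix (Fin 2) (Fin 2) (KMW k)
  | .eta => !![eta, 0; 0, eta]
  | .sym a =>
      !![sym (d.res a), 0;
        epsInt k (d.ord a) * angle (d.res a),
        eps * sym (d.res a) + epsInt k (d.ord a) * angle (d.res a) * sym (-1)]

theorem eta_eps_mul (x : KMW k) : eta * (eps * x) = eta * x := by
  rw [← mul_assoc, eta_comm eps, eps_eta]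

theorem eta_mul_sym_mul (a : kˣ) (x : KMW k) : eta * (sym a * x) = angle a * x - x := by
  rw [← mul_assoc, eta_mul_sym, sub_mul, one_mul]

theorem central_mul {a b : KMW k} (ha : ∀ x, a * x = x * a) (hb : ∀ x, b * x = x * b)
    (x : KMW k) : a * b * x = x * (a * b) := by
  rw [mul_assoc, hb, ← mul_assoc, ha, mul_assoc]

theorem coeff_comm (n : ℤ) (u : kˣ) (x : KMW k) :
    epsInt k n * angle u * x = x * (epsInt k n * angle u) :=
  central_mul (epsInt_comm n) (angle_comm u) x

theorem eta_lower (n : ℤ) (u : kˣ) :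
    eta * (eps * sym u + epsInt k n * angle u * sym (-1))
      = (angle u - 1) + epsInt k n * angle u * (angle (-1) - 1) := by
  rw [mul_add, ← mul_assoc, eta_comm eps, eps_eta, eta_mul_sym, ← mul_assoc,
    ← coeff_comm, mul_assoc, eta_mul_sym]

theorem coeff_mul (n m : ℤ) (u w : kˣ) :
    epsInt k (n + m) * angle (u * w) =
      epsInt k n * angle u + epsInt k m * angle w
      + epsInt k n * angle u * (angle w - 1)
      + ((angle u - 1) + epsInt k n * angle u * (angle (-1) - 1)) * (epsInt k m * angle w) := by
  have lift {z : KMW k} (h : ∀ x, z * x = x * z) : ∃ c : Subring.center (KMW k), (c : KMW k) = z :=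
    ⟨⟨z, Subring.mem_center_iff.mpr fun x => (h x).symm⟩, rfl⟩
  obtain ⟨N, hN⟩ := lift (epsInt_comm (F := k) n)
  obtain ⟨M, hM⟩ := lift (epsInt_comm (F := k) m)
  obtain ⟨U, hU⟩ := lift (angle_comm u)
  obtain ⟨W, hW⟩ := lift (angle_comm w)
  obtain ⟨D, hD⟩ := lift (angle_comm (-1 : kˣ))
  rw [epsInt_add, angle_mul, ← hN, ← hM, ← hU, ← hW, ← hD]
  have : (N + M + N * M * (D - 1)) * (U * W) = N * U + M * W + N * U * (W - 1)
      + ((U - 1) + N * U * (D - 1)) * (M * W) := by ring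
  exact congrArg Subtype.val this

theorem thetaGen_mul (d : UnitPart F k) (a b : Fˣ) : thetaGen d (.sym (a * b)) =
    thetaGen d (.sym a) + thetaGen d (.sym b)
      + thetaGen d .eta * thetaGen d (.sym a) * thetaGen d (.sym b) := by
  simp only [thetaGen, Matrix.mul_fin_two, d.ord_mul, d.res_mul, zero_mul, mul_zero, add_zero,
    zero_add, eta_lower, coeff_mul]
  generalize d.res a = u
  generalize d.res b = w
  generalize d.ord a = n
  generalize d.ord b = m
  have h₁ : eta * (epsInt k n * angle u) * sym w = epsInt k n * angle u * (angle w - 1) := by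
    rw [← coeff_comm, mul_assoc, eta_mul_sym]
  have h₂ : (angle w - 1) * sym (-1) = (angle (-1 : kˣ) - 1) * (eps * sym w) := by
    rw [← eta_mul_sym, ← eta_mul_sym, eta_sym_sym, ← mul_assoc _ eps, ← eps_comm, ← mul_assoc eps,
      eps_eta]
  have h₃ : epsInt k n * angle u * (angle w - 1) * sym (-1)
      = epsInt k n * angle u * (angle (-1 : kˣ) - 1) * (eps * sym w) := by
    rw [mul_assoc, h₂, ← mul_assoc]
  ext i j
  fin_cases i <;> fin_cases j
  · simp [sym_mul']
  · simp
  · simp [h₁, add_assoc]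
  · simp only [Fin.mk_one, Matrix.add_apply, Matrix.of_apply, Matrix.cons_val', Matrix.cons_val_one,
      Matrix.cons_val_fin_one]
    rw [add_mul _ _ (sym (-1)), add_mul _ _ (sym (-1)), add_mul _ _ (sym (-1)), h₃, sym_mul,
      mul_add eps, ← mul_assoc eps, eps_comm (angle u)]
    noncomm_ring

theorem thetaGen_steinberg (d : UnitPart F k) (a b : Fˣ) (h : (a : F) + b = 1) :
    thetaGen d (.sym a) * thetaGen d (.sym b) = 0 := by
  have h0 : !![(0 : KMW k), 0; 0, 0] = 0 := by ext i j; fin_cases i <;> fin_cases j <;> rfl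
  rcases d.add_eq_one a b h with ⟨h1, h2⟩ | ⟨h1, h2⟩ | ⟨h1, h2, h3⟩ | ⟨h1, h2⟩
  · have : thetaGen d (.sym a) = 0 := by simp [thetaGen, h1, h2, epsInt_zero, sym_one, h0]
    rw [this, zero_mul]
  · have : thetaGen d (.sym b) = 0 := by simp [thetaGen, h1, h2, epsInt_zero, sym_one, h0]
    rw [this, mul_zero]
  · have h4 : eps * sym (d.res a) * (eps * sym (d.res b)) = 0 := by
      rw [eps_comm (sym (d.res b)), ← mul_assoc, mul_assoc eps, steinberg _ _ h3, mul_zero,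
        zero_mul]
    simp only [thetaGen, Matrix.mul_fin_two, h1, h2, epsInt_zero, zero_mul, mul_zero, add_zero,
      steinberg _ _ h3, h4, h0]
  · simp only [thetaGen, Matrix.mul_fin_two, h1, h2, zero_mul, mul_zero, add_zero, zero_add,
      sym_neg_self]
    generalize d.res a = u
    generalize d.ord b = n
    have e₁ : eps * sym u + sym (-u) = sym (-1) := by
      rw [sym_neg, eps, neg_mul]; abel
    have e₂ : epsInt k n * angle u * (epsInt k n * angle (-u)) * sym (-1)
        = -(epsInt k n * sym (-1)) := by
      rw [coeff_comm, mul_assoc (epsInt k n) (angle (-u)), ← mul_assoc (angle (-u)), ← epsInt_comm,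
        mul_assoc (epsInt k n) (angle (-u)), angle_comm (-u), angle_angle_neg, mul_assoc, mul_assoc,
        angle_neg_one_sym, mul_neg, mul_neg, epsInt_sym]
    have e₃ : epsInt k n * angle (-u) * (eps * sym u) = epsInt k n * (eps * sym u) := by
      rw [mul_assoc, ← mul_assoc (angle (-u)), ← eps_comm, mul_assoc eps, angle_neg_sym]
    have e₄ : epsInt k n * angle u * sym (-u) = epsInt k n * sym (-u) := by
      rw [mul_assoc, angle_sym_neg]
    have c₁ : epsInt k n * angle u * sym (-u)
        + (eps * sym u + epsInt k n * angle u * sym (-1)) * (epsInt k n * angle (-u)) = 0 := by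
      rw [← coeff_comm, mul_add, e₃, e₄, ← mul_assoc (epsInt k n * angle (-u)),
        coeff_comm n (-u) (epsInt k n * angle u), e₂, ← e₁, mul_add]
      abel
    have c₂ : (eps * sym u + epsInt k n * angle u * sym (-1))
        * (eps * sym (-u) + epsInt k n * angle (-u) * sym (-1)) = 0 := by
      have t₁ : eps * sym u * (eps * sym (-u)) = 0 := by
        rw [eps_comm (sym (-u)), ← mul_assoc, mul_assoc eps, sym_neg_self, mul_zero, zero_mul]
      have t₂ : eps * sym u * (epsInt k n * angle (-u) * sym (-1))
          = epsInt k n * (sym (-1) * (eps * sym u)) := by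
        rw [← mul_assoc, ← coeff_comm, e₃, mul_assoc, mul_assoc eps, sym_neg_one_comm,
          ← mul_assoc eps, eps_comm, mul_assoc]
      have t₃ : epsInt k n * angle u * sym (-1) * (eps * sym (-u))
          = epsInt k n * (sym (-1) * sym (-u)) := by
        rw [mul_assoc, ← mul_assoc (sym (-1)), ← eps_comm, eps_sym, coeff_comm, mul_assoc,
          ← coeff_comm, e₄, ← mul_assoc, ← epsInt_comm, mul_assoc]
      have t₄ : epsInt k n * angle u * sym (-1) * (epsInt k n * angle (-u) * sym (-1))
          = -(epsInt k n * (sym (-1) * sym (-1))) := by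
        rw [← mul_assoc, mul_assoc (epsInt k n * angle u), ← coeff_comm n (-u) (sym (-1)),
          ← mul_assoc, e₂, neg_mul, mul_assoc]
      rw [add_mul, mul_add, mul_add, t₁, t₂, t₃, t₄, zero_add, ← add_assoc, ← mul_add, ← mul_add,
        e₁, add_neg_cancel]
    rw [c₁, c₂, h0]

theorem thetaGen_comm (d : UnitPart F k) (a : Fˣ) :
    thetaGen d .eta * thetaGen d (.sym a) = thetaGen d (.sym a) * thetaGen d .eta := by
  simp only [thetaGen, Matrix.mul_fin_two, zero_mul, mul_zero, add_zero, zero_add, eta_comm]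

theorem thetaGen_eta (d : UnitPart F k) :
    (2 + thetaGen d .eta * thetaGen d (.sym (-1))) * thetaGen d .eta = 0 := by
  have h : thetaGen d .eta * thetaGen d (.sym (-1)) * thetaGen d .eta
      = -(thetaGen d .eta + thetaGen d .eta) := by
    have h2 : eta * sym (-1 : kˣ) * eta = -(eta + eta) := by
      have := eta_rel (F := k)
      rw [add_mul, two_mul] at this
      exact eq_neg_of_add_eq_zero_right this
    simp only [thetaGen, Matrix.mul_fin_two, d.ord_neg_one, d.res_neg_one, epsInt_zero, eps_sym,
      zero_mul, mul_zero, add_zero, zero_add, h2]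
    ext i j
    fin_cases i <;> fin_cases j <;> simp
  rw [add_mul, h, two_mul, add_neg_cancel]

/-- The ring homomorphism `Θ(x) = s(x) + ξ ∂(x)`. -/
noncomputable def theta (d : UnitPart F k) : KMW F →+* Matrix (Fin 2) (Fin 2) (KMW k) :=
  RingQuot.lift ⟨(FreeAlgebra.lift ℤ (thetaGen d)).toRingHom, by
    intro x y h
    cases h with
    | steinberg a b h => simpa using thetaGen_steinberg d a b h
    | mul a b => simpa using thetaGen_mul d a b
    | comm a => simpa using thetaGen_comm d a
    | eta => simpa [← one_add_one_eq_two] using thetaGen_eta d⟩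

theorem theta_gen (d : UnitPart F k) (g : Gen F) : theta d (gen g) = thetaGen d g := by
  have : theta d (mk F (FreeAlgebra.ι ℤ g)) = FreeAlgebra.lift ℤ (thetaGen d) (FreeAlgebra.ι ℤ g) :=
    RingQuot.lift_mkRingHom_apply _ _ _
  rw [gen, this, FreeAlgebra.lift_ι_apply]

/-- The residue homomorphism `∂`, the coefficient of `ξ` in `Θ`. -/
noncomputable def residueMap (d : UnitPart F k) : KMW F →+ KMW k where
  toFun x := theta d x 1 0
  map_zero' := by simp
  map_add' := by simp

theorem residueMap_eta_mul (d : UnitPart F k) (x : KMW F) :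
    residueMap d (eta * x) = eta * residueMap d x := by
  have h : theta d eta = !![eta, 0; 0, eta] := theta_gen d .eta
  simp [residueMap, h, Matrix.mul_apply, Fin.sum_univ_two]

theorem theta_units (d : UnitPart F k) (l : List Fˣ) (hl : ∀ u ∈ l, d.ord u = 0) :
    theta d (l.map sym).prod 0 0 = (l.map fun u => sym (d.res u)).prod ∧
    theta d (l.map sym).prod 1 0 = 0 := by
  induction l with
  | nil => simp
  | cons u l ih =>
    have h : theta d (sym u) = _ := theta_gen d (.sym u)
    obtain ⟨h₁, h₂⟩ := ih fun v hv => hl v (List.mem_cons_of_mem _ hv)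
    simp [h, thetaGen, Matrix.mul_apply, Fin.sum_univ_two, h₁, h₂, hl u List.mem_cons_self,
      epsInt_zero]

/-- `∂([u₁, …, uₙ]) = 0` for units `uᵢ`. -/
theorem residueMap_units (d : UnitPart F k) (l : List Fˣ) (hl : ∀ u ∈ l, d.ord u = 0) :
    residueMap d (l.map sym).prod = 0 := (theta_units d l hl).2

/-- `∂([π, u₁, …, uₙ]) = [ū₁, …, ūₙ]` for units `uᵢ`. -/
theorem residueMap_uniformizer (d : UnitPart F k) (π : Fˣ) (hπ : d.ord π = 1) (hπ' : d.res π = 1)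
    (l : List Fˣ) (hl : ∀ u ∈ l, d.ord u = 0) :
    residueMap d (sym π * (l.map sym).prod) = (l.map fun u => sym (d.res u)).prod := by
  have h : theta d (sym π) = _ := theta_gen d (.sym π)
  obtain ⟨h₁, h₂⟩ := theta_units d l hl
  simp [residueMap, h, thetaGen, Matrix.mul_apply, Fin.sum_univ_two, h₁, h₂, hπ, hπ', epsInt_one,
    angle_one]

theorem gen_mem (g : Gen k) : gen g ∈ piece k g.degree :=
  AddSubgroup.subset_closure ⟨[g], by simp, by simp⟩

theorem one_mem : (1 : KMW k) ∈ piece k 0 :=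
  AddSubgroup.subset_closure ⟨[], by simp, by simp⟩

theorem mul_mem {m n : ℤ} {x y : KMW k} (hx : x ∈ piece k m) (hy : y ∈ piece k n) :
    x * y ∈ piece k (m + n) := by
  induction hx using AddSubgroup.closure_induction with
  | mem x hx =>
    obtain ⟨l, hl, rfl⟩ := hx
    induction hy using AddSubgroup.closure_induction with
    | mem y hy =>
      obtain ⟨l', hl', rfl⟩ := hy
      exact AddSubgroup.subset_closure ⟨l ++ l', by simp [hl, hl'], by simp⟩
    | zero => rw [mul_zero]; exact zero_mem _
    | add x y _ _ h h' => rw [mul_add]; exact add_mem h h'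
    | neg x _ h => rw [mul_neg]; exact neg_mem h
  | zero => rw [zero_mul]; exact zero_mem _
  | add x y _ _ h h' => rw [add_mul]; exact add_mem h h'
  | neg x _ h => rw [neg_mul]; exact neg_mem h

theorem eta_mem : eta ∈ piece k (-1) := gen_mem Gen.eta

theorem sym_mem (u : kˣ) : sym u ∈ piece k 1 := gen_mem (Gen.sym u)

theorem angle_mem (u : kˣ) : angle u ∈ piece k 0 := by
  have h := mul_mem eta_mem (sym_mem u)
  rw [neg_add_cancel] at h
  exact add_mem one_mem h

theorem int_mul_mem (m n : ℤ) {x : KMW k} (hx : x ∈ piece k n) : (m : KMW k) * x ∈ piece k n := by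
  rw [← zsmul_eq_mul]; exact zsmul_mem hx m

theorem epsInt_mem (n : ℤ) : epsInt k n ∈ piece k 0 := by
  have := int_mul_mem (n % 2) 0 (one_mem (k := k))
  rw [mul_one] at this
  exact add_mem (int_mul_mem _ _ (add_mem one_mem (angle_mem _))) this

theorem thetaGen_mem (d : UnitPart F k) (g : Gen F) :
    thetaGen d g 0 0 ∈ piece k g.degree ∧ thetaGen d g 0 1 = 0 ∧
    thetaGen d g 1 0 ∈ piece k (g.degree - 1) ∧ thetaGen d g 1 1 ∈ piece k g.degree := by
  cases g with
  | eta => exact ⟨eta_mem, rfl, zero_mem _, eta_mem⟩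
  | sym a =>
    have hc := mul_mem (epsInt_mem (k := k) (d.ord a)) (angle_mem (d.res a))
    rw [add_zero] at hc
    have he : (eps : KMW k) ∈ piece k 0 := neg_mem (angle_mem _)
    have h₁ := mul_mem he (sym_mem (d.res a))
    have h₂ := mul_mem hc (sym_mem (-1))
    rw [zero_add] at h₁ h₂
    exact ⟨sym_mem _, rfl, hc, add_mem h₁ h₂⟩

theorem theta_mem (d : UnitPart F k) (l : List (Gen F)) :
    theta d (l.map gen).prod 0 0 ∈ piece k (l.map Gen.degree).sum ∧
    theta d (l.map gen).prod 1 0 ∈ piece k ((l.map Gen.degree).sum - 1) := by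
  induction l with
  | nil => simpa using! one_mem
  | cons g l ih =>
    obtain ⟨h₁, h₂, h₃, h₄⟩ := thetaGen_mem d g
    obtain ⟨h₅, h₆⟩ := ih
    simp only [List.map_cons, List.prod_cons, List.sum_cons, map_mul, theta_gen, Matrix.mul_apply,
      Fin.sum_univ_two, h₂, zero_mul, add_zero]
    refine ⟨mul_mem h₁ h₅, add_mem ?_ ?_⟩
    · have := mul_mem h₃ h₅
      rwa [sub_add_eq_add_sub] at this
    · have := mul_mem h₄ h₆
      rwa [← add_sub_assoc] at this

theorem residueMap_mem (d : UnitPart F k) (n : ℤ) {x : KMW F} (hx : x ∈ piece F n) :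
    residueMap d x ∈ piece k (n - 1) := by
  induction hx using AddSubgroup.closure_induction with
  | mem x hx => obtain ⟨l, rfl, rfl⟩ := hx; exact (theta_mem d l).2
  | zero => rw [map_zero]; exact zero_mem _
  | add x y _ _ hx hy => rw [map_add]; exact add_mem hx hy
  | neg x _ hx => rw [map_neg]; exact neg_mem hx

end Residue
end KMW

section Rational

/-- The uniformizers of the `p`-adic valuation on `ℚ`. -/
abbrev Uniformizer (p : ℕ) : Type := {π : ℚˣ // padicValRat p (π : ℚ) = 1}

variable {p : ℕ}

/-- The `p`-adic unit `a / π ^ v(a)`. -/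
noncomputable def unitOf (π : Uniformizer p) (a : ℚˣ) : ℚ :=
  a * (π.1 : ℚ) ^ (-padicValRat p (a : ℚ))

theorem unitOf_ne_zero (π : Uniformizer p) (a : ℚˣ) : unitOf π a ≠ 0 :=
  mul_ne_zero a.ne_zero (zpow_ne_zero _ π.1.ne_zero)

theorem unitOf_of_val (π : Uniformizer p) {a : ℚˣ} (h : padicValRat p (a : ℚ) = 0) :
    unitOf π a = a := by simp [unitOf, h]

variable [hp : Fact p.Prime]

theorem den_ne_zero_of_val_nonneg {q : ℚ} (h : 0 ≤ padicValRat p q) :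
    ((q.den : ℕ) : ZMod p) ≠ 0 := by
  intro h0
  rw [ZMod.natCast_eq_zero_iff] at h0
  have h1 : ¬ (p : ℤ) ∣ q.num := by
    intro h2
    have := Nat.dvd_gcd (Int.natCast_dvd.mp h2) h0
    rw [q.reduced] at this
    exact hp.out.one_lt.ne' (Nat.dvd_one.mp this)
  rw [padicValRat, padicValInt.eq_zero_of_not_dvd h1] at h
  have := one_le_padicValNat_of_dvd q.den_ne_zero h0
  omega

theorem cast_eq_zero_of_val_pos {q : ℚ} (h : 0 < padicValRat p q) : (q : ZMod p) = 0 := by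
  have h1 : (p : ℤ) ∣ q.num := by
    by_contra h1
    rw [padicValRat, padicValInt.eq_zero_of_not_dvd h1] at h
    omega
  rw [Rat.cast_def, (ZMod.intCast_zmod_eq_zero_iff_dvd _ _).mpr h1, zero_div]

theorem cast_unit_ne_zero {q : ℚ} (hq : q ≠ 0) (h : padicValRat p q = 0) :
    (q : ZMod p) ≠ 0 := by
  have hd := den_ne_zero_of_val_nonneg h.ge
  rw [Rat.cast_def]
  refine div_ne_zero (fun h0 => ?_) hd
  rw [ZMod.intCast_zmod_eq_zero_iff_dvd] at h0
  have h1 : ¬ p ∣ q.den := by rwa [Ne, ZMod.natCast_eq_zero_iff] at hd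
  rw [padicValRat, padicValNat.eq_zero_of_not_dvd h1, padicValInt] at h
  have := one_le_padicValNat_of_dvd (Int.natAbs_ne_zero.mpr (Rat.num_ne_zero.mpr hq))
    (Int.natCast_dvd.mp h0)
  omega

theorem cast_add_of_val_nonneg {q r : ℚ} (h : 0 ≤ padicValRat p q)
    (h' : 0 ≤ padicValRat p r) : ((q + r : ℚ) : ZMod p) = q + r :=
  Rat.cast_add_of_ne_zero (den_ne_zero_of_val_nonneg h) (den_ne_zero_of_val_nonneg h')

theorem val_unitOf (π : Uniformizer p) (a : ℚˣ) : padicValRat p (unitOf π a) = 0 := by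
  rw [unitOf, padicValRat.mul a.ne_zero (zpow_ne_zero _ π.1.ne_zero), padicValRat.zpow, π.2]
  ring

theorem unitOf_mul (π : Uniformizer p) (a b : ℚˣ) :
    unitOf π (a * b) = unitOf π a * unitOf π b := by
  rw [unitOf, unitOf, unitOf, Units.val_mul, padicValRat.mul a.ne_zero b.ne_zero, neg_add,
    zpow_add₀ π.1.ne_zero, mul_mul_mul_comm]

theorem val_of_add_eq_one {a b : ℚˣ} (hab : (a : ℚ) + b = 1) (ha : 0 < padicValRat p (a : ℚ)) :
    padicValRat p (b : ℚ) = 0 ∧ ((b : ℚ) : ZMod p) = 1 := by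
  have hb : (b : ℚ) = 1 + -a := by rw [← hab]; ring
  have h0 : padicValRat p (b : ℚ) = 0 := by
    rw [hb, padicValRat.add_eq_of_lt (by rw [← hb]; exact b.ne_zero) one_ne_zero
      (neg_ne_zero.mpr a.ne_zero) (by simpa using ha), padicValRat.one]
  refine ⟨h0, ?_⟩
  have := cast_add_of_val_nonneg (p := p) ha.le h0.ge
  rw [hab, cast_eq_zero_of_val_pos ha, zero_add, Rat.cast_one] at this
  exact this.symm

theorem val_eq_of_add_eq_one {a b : ℚˣ} (hab : (a : ℚ) + b = 1)
    (ha : ¬ 0 < padicValRat p (a : ℚ)) (hb : ¬ 0 < padicValRat p (b : ℚ)) :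
    padicValRat p (a : ℚ) = padicValRat p (b : ℚ) := by
  have h1 : padicValRat p ((a : ℚ) + b) = 0 := by rw [hab, padicValRat.one]
  have h2 : (a : ℚ) + b ≠ 0 := by rw [hab]; exact one_ne_zero
  rcases lt_trichotomy (padicValRat p (a : ℚ)) (padicValRat p (b : ℚ)) with h | h | h
  · rw [padicValRat.add_eq_of_lt h2 a.ne_zero b.ne_zero h] at h1
    omega
  · exact h
  · rw [add_comm] at h1 h2
    rw [padicValRat.add_eq_of_lt h2 b.ne_zero a.ne_zero h] at h1
    omega

/-- The `p`-adic valuation on `ℚ` and, for a uniformizer `π`, the residue in `𝔽_p` of the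
`p`-adic unit `a / π ^ v(a)`. -/
noncomputable def unitPart (π : Uniformizer p) : KMW.UnitPart ℚ (ZMod p) where
  ord a := padicValRat p (a : ℚ)
  res a := Units.mk0 (unitOf π a : ZMod p) (cast_unit_ne_zero (unitOf_ne_zero π a) (val_unitOf π a))
  ord_mul a b := by rw [Units.val_mul, padicValRat.mul a.ne_zero b.ne_zero]
  res_mul a b := by
    ext
    simp only [Units.val_mul, Units.val_mk0, unitOf_mul]
    exact Rat.cast_mul_of_ne_zero
      (den_ne_zero_of_val_nonneg (val_unitOf π a).ge)
      (den_ne_zero_of_val_nonneg (val_unitOf π b).ge)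
  ord_neg_one := by simp
  res_neg_one := by
    ext
    simp [unitOf]
  add_eq_one a b hab := by
    by_cases ha : 0 < padicValRat p (a : ℚ)
    · obtain ⟨h₁, h₂⟩ := val_of_add_eq_one hab ha
      exact Or.inr (Or.inl ⟨h₁, Units.ext (by simp [unitOf_of_val π h₁, h₂])⟩)
    by_cases hb : 0 < padicValRat p (b : ℚ)
    · obtain ⟨h₁, h₂⟩ := val_of_add_eq_one ((add_comm _ _).trans hab) hb
      exact Or.inl ⟨h₁, Units.ext (by simp [unitOf_of_val π h₁, h₂])⟩
    have h := val_eq_of_add_eq_one hab ha hb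
    by_cases h0 : padicValRat p (a : ℚ) = 0
    · have h0' : padicValRat p (b : ℚ) = 0 := h ▸ h0
      refine Or.inr (Or.inr (Or.inl ⟨h0, h0', ?_⟩))
      have := cast_add_of_val_nonneg (p := p) h0.ge h0'.ge
      simp [unitOf_of_val π h0, unitOf_of_val π h0', ← this, hab]
    · refine Or.inr (Or.inr (Or.inr ⟨h, Units.ext ?_⟩))
      have h1 := cast_add_of_val_nonneg (p := p)
        (val_unitOf π a).ge (val_unitOf π b).ge
      have h2 : unitOf π a + unitOf π b = (π.1 : ℚ) ^ (-padicValRat p (a : ℚ)) := by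
        rw [unitOf, unitOf, ← h, ← add_mul, hab, one_mul]
      have h3 : 0 < padicValRat p ((π.1 : ℚ) ^ (-padicValRat p (a : ℚ))) := by
        rw [padicValRat.zpow, π.2]
        omega
      rw [h2, cast_eq_zero_of_val_pos h3] at h1
      simpa using eq_neg_of_add_eq_zero_right h1.symm

/-- The residue homomorphism `∂ : K^MW_n(ℚ) → K^MW_{n-1}(𝔽_p)` attached to a uniformizer `π` of
the `p`-adic valuation. -/
noncomputable def residue (π : Uniformizer p) (n : ℤ) :
    KMW.piece ℚ n →+ KMW.piece (ZMod p) (n - 1) :=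
  ((KMW.residueMap (unitPart π)).comp (KMW.piece ℚ n).subtype).codRestrict _
    fun x => KMW.residueMap_mem (unitPart π) n x.2

theorem unitPart_uniformizer (π : Uniformizer p) :
    (unitPart π).ord π.1 = 1 ∧ (unitPart π).res π.1 = 1 := by
  refine ⟨π.2, Units.ext ?_⟩
  simp [unitPart, unitOf, π.2]

theorem unitPart_unit (π : Uniformizer p) (u : ℚˣ) (hu : padicValRat p (u : ℚ) = 0) :
    (unitPart π).ord u = 0 ∧ ((unitPart π).res u : ZMod p) = ((u : ℚ) : ZMod p) :=
  ⟨hu, by simp [unitPart, unitOf_of_val π hu]⟩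

instance (p : Nat.Primes) : Fact (p : ℕ).Prime := ⟨p.2⟩

end Rational

section GrothendieckWitt

/-- A nondegenerate symmetric bilinear form on `k ^ rank`. -/
structure SymForm (k : Type*) [Field k] where
  rank : ℕ
  form : LinearMap.BilinForm k (Fin rank → k)
  symm : form.IsSymm
  nondegenerate : form.Nondegenerate

/-- `C` is isometric to the orthogonal sum of `A` and `B`. -/
def SymForm.IsOrthogonalSum {k : Type*} [Field k] (A B C : SymForm k) : Prop :=
  ∃ e : ((Fin A.rank → k) × (Fin B.rank → k)) ≃ₗ[k] (Fin C.rank → k),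
    ∀ x y, C.form (e x) (e y) = A.form x.1 y.1 + B.form x.2 y.2

/-- The Grothendieck-Witt group `GW(k)`: the Grothendieck group of isometry classes of
nondegenerate symmetric bilinear forms over `k` under orthogonal sum, presented by one generator
for each form and the relation `[C] = [A] + [B]` whenever `C` is isometric to the orthogonal sum of
`A` and `B` (for `B` of rank `0` this identifies isometric forms). -/
def GW (k : Type*) [Field k] :=
  FreeAbelianGroup (SymForm k) ⧸ AddSubgroup.closure
    {x : FreeAbelianGroup (SymForm k) | ∃ A B C : SymForm k, A.IsOrthogonalSum B C ∧
      x = FreeAbelianGroup.of C - (FreeAbelianGroup.of A + FreeAbelianGroup.of B)}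

noncomputable instance (k : Type*) [Field k] : AddCommGroup (GW k) :=
  inferInstanceAs (AddCommGroup (FreeAbelianGroup (SymForm k) ⧸ AddSubgroup.closure _))

/-- The form `⟨u⟩ : (x, y) ↦ u x y` of rank one. -/
noncomputable def SymForm.rankOne {k : Type*} [Field k] (u : kˣ) : SymForm k where
  rank := 1
  form := Matrix.toBilin' !![(u : k)]
  symm := ⟨fun x y => by simp [Matrix.toBilin'_apply, mul_comm, mul_left_comm]⟩
  nondegenerate := LinearMap.BilinForm.nondegenerate_toBilin'_of_det_ne_zero' _ (by simp)

/-- The class of `⟨u⟩` in `GW(k)`. -/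
noncomputable def GW.rankOne {k : Type*} [Field k] (u : kˣ) : GW k :=
  QuotientAddGroup.mk (FreeAbelianGroup.of (SymForm.rankOne u))

end GrothendieckWitt
end MilnorWitt

/-!
The decomposition is the Milnor-Witt analogue of the theorem of Milnor and Tate on `K^M_*(ℚ)`. Let
`L_N` be the subring of `K^MW_*(ℚ)` generated by `η`, `[-1]` and the symbols `[q]` of the primes
`q < N` (`KMW.filtration`). These subrings exhaust `K^MW_*(ℚ)`, the residues at the primes `≥ N`
vanish on `L_N`, and `L_{p+1} = L_p + [p] L_p`. The residue of `[p] b` at `p` is, up to the unit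
`⟨p / π⟩`, the specialization of `b` to `K^MW_*(𝔽_p)`. So the point is that `[p] b` lies in `L_p`
whenever `b ∈ L_p` specializes to `0`.

The elements `b ∈ L_p` with `[p] b ∈ L_p` form a two-sided ideal (`KMW.divIdeal`). If `a = b + p c`
with `a`, `b`, `c` products of `-1` and powers of primes `< p`, the Steinberg relation for
`p c / a + b / a = 1` shows that `[a]` and `[b]` agree modulo this ideal (`KMW.mk_sym_eq`).
Consequently `[ū] ↦ [u]` for `0 < u < p` respects the defining relations and gives a ring
homomorphism from `K^MW_*(𝔽_p)` to the quotient, which inverts specialization (`KMW.liftHom`,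
`KMW.liftHom_specialize`). Hence the joint kernel of the residues is `L_0`, the subring generated by
`η` and `[-1]`. Its part of degree `n` is infinite cyclic for `n ≠ 0` and free on `1`, `η[-1]` for
`n = 0`; suitably normalized signatures, together with the rank for `n = 0`, split it off. The
residues are jointly surjective by induction on the largest prime in the support.

Over `𝔽_p` all products of two symbols vanish, because a form `g x² + g y²` with `g` a nonsquare
represents `1` and so gives a Steinberg relation (`KMW.sym_mul_sym_eq_zero`). Therefore `K^MW_n`
is `0` for `n ≥ 2`, consists of symbols for `n = 1`, and of the elements `m + η[u]` for `n = 0`. The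
Grothendieck-Witt group is generated by forms of rank one (`GW.cls_mem_closure`) and maps to
`K^MW_0(𝔽_p)` by `rank + η[disc]`; this is injective because `η[u] = 0` forces `u` to be a square
(`KMW.isSquare_of_eta_mul_sym_eq_zero`).
-/

namespace MilnorWitt

namespace KMW

/-! ### Symbols, and homomorphisms out of the Milnor-Witt ring -/

section Symbols

variable {F : Type*} [Field F]

theorem sym_mul_self (a : Fˣ) : sym a * sym a = sym a * sym (-1) := by
  have h := congrArg (fun x => angle (-1) * x) (sym_neg_self a)
  simp only [sym_neg a, mul_add, mul_zero] at h
  rw [← mul_assoc (sym a) (angle (-1)), ← angle_comm, mul_assoc (angle (-1)) (sym a),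
    ← mul_assoc (angle (-1)) (angle (-1)), angle_neg_one_sq, one_mul, ← mul_assoc (angle (-1)),
    angle_comm, mul_assoc, angle_comm, ← angle_comm, angle_neg_one_sym, mul_neg] at h
  exact (neg_add_eq_zero.mp h).symm

/-- Symbols commute up to `ε`. -/
theorem sym_mul_sym_comm (a b : Fˣ) : sym a * sym b = eps * (sym b * sym a) := by
  -- Expand `[ab][-ab] = 0`.
  have h := sym_neg_self (b * a)
  rw [← neg_mul, sym_mul, sym_mul (-b), add_mul, mul_add, mul_add, sym_neg_self, zero_add,
    ← mul_assoc (sym b), ← angle_comm, angle_neg_sym,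
    show angle b * sym a * (angle (-b) * sym a) = angle (-1) * (sym a * sym (-1)) by
      rw [← sym_mul_self, mul_assoc, ← mul_assoc (sym a), ← angle_comm, mul_assoc, ← mul_assoc,
        angle_angle_neg],
    show angle b * sym a * sym (-b) = sym a * sym (-b) by
      rw [angle_comm, mul_assoc, angle_sym_neg],
    sym_neg b, mul_add, ← mul_assoc (sym a), ← angle_comm, mul_assoc, add_assoc] at h
  have h1 : angle (-1) * (sym a * sym (-1)) = -(sym a * sym (-1)) := by
    rw [← mul_assoc, angle_comm, mul_assoc, angle_neg_one_sym, mul_neg]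
  rw [h1] at h
  have h2 : sym b * sym a + angle (-1) * (sym a * sym b) = 0 := by
    rw [← h]; abel
  have h3 := congrArg (fun x => angle (-1) * x) h2
  simp only [mul_add, mul_zero] at h3
  rw [← mul_assoc (angle (-1)) (angle (-1)), angle_neg_one_sq, one_mul] at h3
  rw [eps, neg_mul]
  exact (neg_eq_of_add_eq_zero_right h3).symm

theorem angle_inv (a : Fˣ) : angle a⁻¹ = angle a := by
  have h : a⁻¹ = a * (a⁻¹ * a⁻¹) := by group
  rw [h, angle_mul, angle_sq, mul_one]

theorem sym_inv_eq (a : Fˣ) : sym a⁻¹ = -(angle a * sym a) := by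
  rw [sym_inv a⁻¹, inv_inv, angle_inv]

/-- The units whose symbol lies in a given subring. -/
noncomputable def symSubgroup (R : Subring (KMW F)) (hR : eta ∈ R) : Subgroup Fˣ where
  carrier := {u | sym u ∈ R}
  one_mem' := by
    change sym 1 ∈ R
    rw [sym_one]; exact R.zero_mem
  mul_mem' {a b} ha hb := by
    change sym (a * b) ∈ R
    rw [sym_mul']
    exact R.add_mem (R.add_mem ha hb) (R.mul_mem (R.mul_mem hR ha) hb)
  inv_mem' {a} ha := by
    change sym a⁻¹ ∈ R
    rw [sym_inv_eq, angle]
    exact R.neg_mem (R.mul_mem (R.add_mem R.one_mem (R.mul_mem hR ha)) ha)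

/-- The units whose symbol is annihilated by left multiplication by `x`. -/
def symAnnihilator (x : KMW F) : Subgroup Fˣ where
  carrier := {u | x * sym u = 0}
  one_mem' := by simp [sym_one]
  mul_mem' {a b} ha hb := by
    have ha : x * sym a = 0 := ha
    have hb : x * sym b = 0 := hb
    change x * sym (a * b) = 0
    rw [sym_mul, mul_add, ha, zero_add, ← mul_assoc, ← angle_comm, mul_assoc, hb, mul_zero]
  inv_mem' {a} ha := by
    have ha : x * sym a = 0 := ha
    change x * sym a⁻¹ = 0
    rw [sym_inv_eq, mul_neg, ← mul_assoc, ← angle_comm, mul_assoc, ha, mul_zero, neg_zero]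

theorem mem_symAnnihilator {x : KMW F} {u : Fˣ} : u ∈ symAnnihilator x ↔ x * sym u = 0 := Iff.rfl

/-- The universal property of the Milnor-Witt ring. -/
noncomputable def lift {R : Type*} [Ring R] (t : R) (f : Fˣ → R)
    (steinberg : ∀ a b : Fˣ, (a : F) + b = 1 → f a * f b = 0)
    (mul : ∀ a b, f (a * b) = f a + f b + t * f a * f b)
    (comm : ∀ a, t * f a = f a * t) (rel : (2 + t * f (-1)) * t = 0) : KMW F →+* R :=
  RingQuot.lift ⟨(FreeAlgebra.lift ℤ (fun g : Gen F => Gen.casesOn g t f)).toRingHom, by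
    intro x y h
    cases h with
    | steinberg a b h => simpa using steinberg a b h
    | mul a b => simpa using mul a b
    | comm a => simpa using comm a
    | eta => simpa [← one_add_one_eq_two] using rel⟩

section lift

variable {R : Type*} [Ring R] {t : R} {f : Fˣ → R}
    {h₁ : ∀ a b : Fˣ, (a : F) + b = 1 → f a * f b = 0}
    {h₂ : ∀ a b, f (a * b) = f a + f b + t * f a * f b}
    {h₃ : ∀ a, t * f a = f a * t} {h₄ : (2 + t * f (-1)) * t = 0}

theorem lift_gen (g : Gen F) : lift t f h₁ h₂ h₃ h₄ (gen g) = Gen.casesOn g t f := by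
  have : lift t f h₁ h₂ h₃ h₄ (mk F (FreeAlgebra.ι ℤ g))
      = FreeAlgebra.lift ℤ (fun g : Gen F => (Gen.casesOn g t f : R)) (FreeAlgebra.ι ℤ g) :=
    RingQuot.lift_mkRingHom_apply _ _ _
  rw [gen, this, FreeAlgebra.lift_ι_apply]

@[simp] theorem lift_eta : lift t f h₁ h₂ h₃ h₄ eta = t := lift_gen .eta

@[simp] theorem lift_sym (u : Fˣ) : lift t f h₁ h₂ h₃ h₄ (sym u) = f u := lift_gen (.sym u)

end lift

/-- Induction over the homogeneous elements of degree `n`, which are sums of products of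
generators. -/
theorem piece_induction {n : ℤ} {P : KMW F → Prop} {x : KMW F} (hx : x ∈ piece F n)
    (hlist : ∀ l : List (Gen F), (l.map Gen.degree).sum = n → P (l.map gen).prod)
    (hzero : P 0) (hadd : ∀ x y, P x → P y → P (x + y)) (hneg : ∀ x, P x → P (-x)) : P x := by
  induction hx using AddSubgroup.closure_induction with
  | mem x hx => obtain ⟨l, hl, rfl⟩ := hx; exact hlist l hl
  | zero => exact hzero
  | add x y _ _ hx hy => exact hadd x y hx hy
  | neg x _ hx => exact hneg x hx

variable (F) in
/-- The rank `K^MW_*(F) → ℤ`, the projection killing `η` and all symbols. -/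
noncomputable def rank : KMW F →+* ℤ :=
  lift 0 (fun _ => 0) (by simp) (by simp) (by simp) (by simp)

@[simp] theorem rank_eta : rank F eta = 0 := lift_eta

@[simp] theorem rank_sym (u : Fˣ) : rank F (sym u) = 0 := lift_sym u

theorem rank_gen (g : Gen F) : rank F (gen g) = 0 := by
  cases g
  exacts [rank_eta, rank_sym _]

variable (F) in
/-- The ring homomorphism `K^MW_*(F) → K^MW_*(F)[T, T⁻¹]` which multiplies the elements of degree
`n` by `T ^ n`. -/
noncomputable def grade : KMW F →+* AddMonoidAlgebra (KMW F) ℤ :=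
  lift (AddMonoidAlgebra.single (-1) eta) (fun u => AddMonoidAlgebra.single 1 (sym u))
    (fun a b h => by
      rw [AddMonoidAlgebra.single_mul_single, steinberg a b h, AddMonoidAlgebra.single_zero])
    (fun a b => by
      rw [AddMonoidAlgebra.single_mul_single, AddMonoidAlgebra.single_mul_single, sym_mul',
        AddMonoidAlgebra.single_add, AddMonoidAlgebra.single_add, neg_add_cancel, zero_add])
    (fun a => by
      rw [AddMonoidAlgebra.single_mul_single, AddMonoidAlgebra.single_mul_single, eta_sym,
        add_comm])
    (by
      have h := eta_rel (F := F)
      rw [add_mul, two_mul] at h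
      rw [add_mul, two_mul, AddMonoidAlgebra.single_mul_single, AddMonoidAlgebra.single_mul_single,
        neg_add_cancel, zero_add, ← AddMonoidAlgebra.single_add, ← AddMonoidAlgebra.single_add, h,
        AddMonoidAlgebra.single_zero])

theorem grade_gen (g : Gen F) :
    grade F (gen g) = AddMonoidAlgebra.single g.degree (gen g) := by
  cases g
  exacts [lift_eta, lift_sym _]

theorem grade_of_mem {n : ℤ} {x : KMW F} (hx : x ∈ piece F n) :
    grade F x = AddMonoidAlgebra.single n x := by
  refine piece_induction (P := fun x => grade F x = AddMonoidAlgebra.single n x) hx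
    (fun l hl => ?_) (by simp)
    (fun x y hx hy => by rw [map_add, hx, hy, AddMonoidAlgebra.single_add])
    (fun x hx => by rw [map_neg, hx, AddMonoidAlgebra.single_neg])
  · clear hx
    subst hl
    induction l with
    | nil => rw [List.map_nil, List.prod_nil, map_one]; rfl
    | cons g l ih =>
      rw [List.map_cons, List.prod_cons, map_mul, ih, grade_gen,
        AddMonoidAlgebra.single_mul_single, List.map_cons, List.sum_cons]

end Symbols

/-! ### Specialization -/

section Specialization

variable {F k : Type*} [Field F] [Field k]

theorem theta_zero_one (d : UnitPart F k) (x : KMW F) : theta d x 0 1 = 0 := by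
  induction x using KMW.induction with
  | hint m =>
    rw [map_intCast]
    exact Matrix.diagonal_apply_ne _ (by decide)
  | hgen g => rw [theta_gen]; exact (thetaGen_mem d g).2.1
  | hadd x y hx hy => rw [map_add, Matrix.add_apply, hx, hy, add_zero]
  | hmul x y hx hy => simp [Matrix.mul_apply, Fin.sum_univ_two, hx, hy]

/-- The specialization homomorphism `s` of `Θ(x) = s(x) + ξ ∂(x)`. -/
noncomputable def specialize (d : UnitPart F k) : KMW F →+* KMW k where
  toFun x := theta d x 0 0
  map_zero' := by simp
  map_one' := by simp
  map_add' := by simp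
  map_mul' x y := by simp [Matrix.mul_apply, Fin.sum_univ_two, theta_zero_one]

theorem specialize_eta (d : UnitPart F k) : specialize d eta = eta := by
  have h : theta d eta = _ := theta_gen d .eta
  simp [specialize, h, thetaGen]

theorem specialize_sym (d : UnitPart F k) (u : Fˣ) : specialize d (sym u) = sym (d.res u) := by
  have h : theta d (sym u) = _ := theta_gen d (.sym u)
  simp [specialize, h, thetaGen]

theorem residueMap_mul (d : UnitPart F k) (x y : KMW F) :
    residueMap d (x * y) = residueMap d x * specialize d y + theta d x 1 1 * residueMap d y := by
  simp [residueMap, specialize, Matrix.mul_apply, Fin.sum_univ_two]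

theorem residueMap_sym (d : UnitPart F k) (u : Fˣ) :
    residueMap d (sym u) = epsInt k (d.ord u) * angle (d.res u) := by
  have h : theta d (sym u) = _ := theta_gen d (.sym u)
  simp [residueMap, h, thetaGen]

theorem residueMap_eta (d : UnitPart F k) : residueMap d eta = 0 := by
  have h : theta d eta = _ := theta_gen d .eta
  simp [residueMap, h, thetaGen]

/-- The kernel of the residue. It is a subring because `Θ` takes it to diagonal matrices. -/
noncomputable def unramified (d : UnitPart F k) : Subring (KMW F) where
  carrier := {x | residueMap d x = 0}
  zero_mem' := map_zero _
  one_mem' := by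
    have : theta d 1 1 0 = 0 := by simp
    exact this
  add_mem' {x y} hx hy := by
    have hx : residueMap d x = 0 := hx
    have hy : residueMap d y = 0 := hy
    change residueMap d (x + y) = 0
    rw [map_add, hx, hy, add_zero]
  neg_mem' {x} hx := by
    have hx : residueMap d x = 0 := hx
    change residueMap d (-x) = 0
    rw [map_neg, hx, neg_zero]
  mul_mem' {x y} hx hy := by
    have hx : residueMap d x = 0 := hx
    have hy : residueMap d y = 0 := hy
    change residueMap d (x * y) = 0
    rw [residueMap_mul, hx, hy, zero_mul, mul_zero, add_zero]

theorem mem_unramified {d : UnitPart F k} {x : KMW F} :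
    x ∈ unramified d ↔ residueMap d x = 0 := Iff.rfl

end Specialization

/-! ### The filtration of `K^MW_*(ℚ)` by primes -/

section Filtration

/-- The subring `L_N` of `K^MW_*(ℚ)` generated by `η`, `[-1]` and the symbols `[q]` of the primes
`q < N`. -/
noncomputable def filtration (N : ℕ) : Subring (KMW ℚ) :=
  Subring.closure ({eta, sym (-1)} ∪
    {x | ∃ (q : ℕ) (u : ℚˣ), q.Prime ∧ q < N ∧ (u : ℚ) = q ∧ x = sym u})

theorem eta_mem_filtration (N : ℕ) : eta ∈ filtration N :=
  Subring.subset_closure (Or.inl (Or.inl rfl))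

theorem sym_neg_one_mem_filtration (N : ℕ) : sym (-1) ∈ filtration N :=
  Subring.subset_closure (Or.inl (Or.inr rfl))

theorem sym_prime_mem_filtration {N q : ℕ} (hq : q.Prime) (h : q < N) {u : ℚˣ}
    (hu : (u : ℚ) = q) : sym u ∈ filtration N :=
  Subring.subset_closure (Or.inr ⟨q, u, hq, h, hu, rfl⟩)

theorem filtration_mono {M N : ℕ} (h : M ≤ N) : filtration M ≤ filtration N := by
  refine Subring.closure_mono (Set.union_subset_union_right _ ?_)
  rintro x ⟨q, u, hq, hM, hu, rfl⟩
  exact ⟨q, u, hq, hM.trans_le h, hu, rfl⟩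

theorem filtration_succ_of_not_prime {N : ℕ} (h : ¬ N.Prime) :
    filtration (N + 1) = filtration N := by
  refine le_antisymm (Subring.closure_mono (Set.union_subset_union_right _ ?_))
    (filtration_mono N.le_succ)
  rintro x ⟨q, u, hq, hN, hu, rfl⟩
  refine ⟨q, u, hq, lt_of_le_of_ne (Nat.lt_succ_iff.mp hN) ?_, hu, rfl⟩
  rintro rfl
  exact h hq

/-- The units of `ℚ` whose symbol lies in `L_N`. -/
noncomputable abbrev filtrationUnits (N : ℕ) : Subgroup ℚˣ :=
  symSubgroup (filtration N) (eta_mem_filtration N)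

theorem natCast_mem_filtrationUnits {N m : ℕ} (h : m < N) {u : ℚˣ} (hu : (u : ℚ) = m) :
    u ∈ filtrationUnits N := by
  induction m using Nat.strong_induction_on generalizing u with
  | _ m ih =>
    have hm : m ≠ 0 := by rintro rfl; simp at hu
    by_cases h1 : m = 1
    · have : u = 1 := Units.ext (by simp [hu, h1])
      exact this ▸ Subgroup.one_mem _
    have hp := Nat.minFac_prime h1
    obtain ⟨c, hc⟩ := Nat.minFac_dvd m
    have hc0 : c ≠ 0 := by rintro rfl; exact hm (by simpa using hc)
    have hlt : c < m := by
      have := hp.two_le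
      nlinarith [Nat.pos_of_ne_zero hc0]
    have hp0 : (m.minFac : ℚ) ≠ 0 := by exact_mod_cast hp.ne_zero
    have hcq : (c : ℚ) ≠ 0 := by exact_mod_cast hc0
    have huv : u = Units.mk0 _ hp0 * Units.mk0 _ hcq := Units.ext (by
      rw [hu, Units.val_mul, Units.val_mk0, Units.val_mk0, ← Nat.cast_mul, ← hc])
    rw [huv]
    exact Subgroup.mul_mem _ (sym_prime_mem_filtration hp
      ((Nat.minFac_le (Nat.pos_of_ne_zero hm)).trans_lt h) rfl)
      (ih c hlt (hlt.trans h) rfl)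

theorem exists_mem_filtrationUnits (u : ℚˣ) : ∃ N, u ∈ filtrationUnits N := by
  have hn : ((u : ℚ).num.natAbs : ℚ) ≠ 0 := by simp
  have hd : ((u : ℚ).den : ℚ) ≠ 0 := by simp
  set N := (u : ℚ).num.natAbs + (u : ℚ).den + 1
  have h1 : Units.mk0 _ hn ∈ filtrationUnits N :=
    natCast_mem_filtrationUnits (by omega) rfl
  have h2 : Units.mk0 _ hd ∈ filtrationUnits N :=
    natCast_mem_filtrationUnits (by omega) rfl
  have h3 : (-1 : ℚˣ) ∈ filtrationUnits N := sym_neg_one_mem_filtration N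
  refine ⟨N, ?_⟩
  have hu := Rat.num_div_den (u : ℚ)
  rcases Int.natAbs_eq (u : ℚ).num with h | h
  · have : u = Units.mk0 _ hn * (Units.mk0 _ hd)⁻¹ := Units.ext (by
      rw [Units.val_mul, Units.val_inv_eq_inv_val, Units.val_mk0, Units.val_mk0, ← div_eq_mul_inv]
      conv_lhs => rw [← hu, h]
      simp)
    rw [this]
    exact Subgroup.mul_mem _ h1 (Subgroup.inv_mem _ h2)
  · have : u = -1 * (Units.mk0 _ hn * (Units.mk0 _ hd)⁻¹) := Units.ext (by
      rw [Units.val_mul, Units.val_mul, Units.val_inv_eq_inv_val, Units.val_mk0, Units.val_mk0,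
        ← div_eq_mul_inv]
      conv_lhs => rw [← hu, h]
      simp [neg_div])
    rw [this]
    exact Subgroup.mul_mem _ h3 (Subgroup.mul_mem _ h1 (Subgroup.inv_mem _ h2))

theorem exists_mem_filtration (x : KMW ℚ) : ∃ N, x ∈ filtration N := by
  induction x using KMW.induction with
  | hint m => exact ⟨0, intCast_mem _ m⟩
  | hgen g => cases g with
    | eta => exact ⟨0, eta_mem_filtration 0⟩
    | sym u => exact exists_mem_filtrationUnits u
  | hadd x y hx hy =>
    obtain ⟨M, hM⟩ := hx
    obtain ⟨N, hN⟩ := hy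
    exact ⟨max M N, add_mem (filtration_mono (le_max_left M N) hM)
      (filtration_mono (le_max_right M N) hN)⟩
  | hmul x y hx hy =>
    obtain ⟨M, hM⟩ := hx
    obtain ⟨N, hN⟩ := hy
    exact ⟨max M N, Subring.mul_mem _ (filtration_mono (le_max_left M N) hM)
      (filtration_mono (le_max_right M N) hN)⟩

theorem padicValRat_natCast_of_lt {p m : ℕ} (hm : m ≠ 0) (h : m < p) :
    padicValRat p (m : ℚ) = 0 := by
  rw [padicValRat.of_nat, padicValNat.eq_zero_of_not_dvd (Nat.not_dvd_of_pos_of_lt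
    (Nat.pos_of_ne_zero hm) h)]
  rfl

variable {p : ℕ} [hp : Fact p.Prime]

/-- The residues at the primes `p ≥ N` vanish on `L_N`. -/
theorem filtration_le_unramified (π : Uniformizer p) {N : ℕ} (h : N ≤ p) :
    filtration N ≤ unramified (unitPart π) := by
  refine Subring.closure_le.mpr ?_
  rintro x ((rfl | rfl) | ⟨q, u, hq, hN, hu, rfl⟩)
  · exact residueMap_eta _
  · rw [SetLike.mem_coe, mem_unramified, residueMap_sym, (unitPart π).ord_neg_one, epsInt_zero,
      zero_mul]
  · have : (unitPart π).ord u = 0 := by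
      change padicValRat p (u : ℚ) = 0
      rw [hu]
      exact padicValRat_natCast_of_lt hq.ne_zero (by omega)
    rw [SetLike.mem_coe, mem_unramified, residueMap_sym, this, epsInt_zero, zero_mul]

variable (p) in
/-- The prime `p` as a unit of `ℚ`. -/
def primeUnit : ℚˣ := Units.mk0 (p : ℚ) (Nat.cast_ne_zero.mpr hp.out.ne_zero)

theorem ord_primeUnit (π : Uniformizer p) : (unitPart π).ord (primeUnit p) = 1 :=
  padicValRat.self hp.out.one_lt

theorem residueMap_sym_primeUnit (π : Uniformizer p) : residueMap (unitPart π) (sym (primeUnit p))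
    = angle ((unitPart π).res (primeUnit p)) := by
  rw [residueMap_sym, ord_primeUnit, epsInt_one, one_mul]

/-- Elements of `L_N` can be moved past a symbol on either side, by graded commutativity. -/
theorem exists_swap {x : KMW ℚ} {N : ℕ} (v : ℚˣ) (hx : x ∈ filtration N) :
    ∃ y ∈ filtration N, sym v * x = y * sym v ∧ x * sym v = sym v * y := by
  have hsym (u : ℚˣ) (hu : sym u ∈ filtration N) :
      ∃ y ∈ filtration N, sym v * sym u = y * sym v ∧ sym u * sym v = sym v * y := by
    refine ⟨eps * sym u, Subring.mul_mem _ ?_ hu, ?_, ?_⟩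
    · exact Subring.neg_mem _ (Subring.add_mem _ (Subring.one_mem _)
        (Subring.mul_mem _ (eta_mem_filtration N) (sym_neg_one_mem_filtration N)))
    · rw [sym_mul_sym_comm, mul_assoc]
    · rw [sym_mul_sym_comm, ← mul_assoc, eps_comm, mul_assoc]
  induction hx using Subring.closure_induction with
  | mem x hx =>
    rcases hx with (rfl | rfl) | ⟨q, u, hq, hN, hu, rfl⟩
    · exact ⟨eta, eta_mem_filtration N, (eta_comm _).symm, eta_comm _⟩
    · exact hsym _ (sym_neg_one_mem_filtration N)
    · exact hsym _ (sym_prime_mem_filtration hq hN hu)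
  | zero => exact ⟨0, Subring.zero_mem _, by simp, by simp⟩
  | one => exact ⟨1, Subring.one_mem _, by simp, by simp⟩
  | add x y _ _ hx hy =>
    obtain ⟨a, ha, h₁, h₂⟩ := hx
    obtain ⟨b, hb, h₃, h₄⟩ := hy
    exact ⟨a + b, Subring.add_mem _ ha hb, by rw [mul_add, h₁, h₃, add_mul],
      by rw [add_mul, h₂, h₄, mul_add]⟩
  | neg x _ hx =>
    obtain ⟨a, ha, h₁, h₂⟩ := hx
    exact ⟨-a, Subring.neg_mem _ ha, by rw [mul_neg, h₁, neg_mul],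
      by rw [neg_mul, h₂, mul_neg]⟩
  | mul x y _ _ hx hy =>
    obtain ⟨a, ha, h₁, h₂⟩ := hx
    obtain ⟨b, hb, h₃, h₄⟩ := hy
    exact ⟨a * b, Subring.mul_mem _ ha hb, by rw [← mul_assoc, h₁, mul_assoc, h₃, mul_assoc],
      by rw [mul_assoc, h₄, ← mul_assoc, h₂, mul_assoc]⟩

variable (p) in
/-- `L_{p+1} = L_p + [p] L_p`. -/
theorem exists_of_mem_filtration_succ {x : KMW ℚ} (hx : x ∈ filtration (p + 1)) :
    ∃ a ∈ filtration p, ∃ b ∈ filtration p, x = a + sym (primeUnit p) * b := by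
  set P := sym (primeUnit p)
  let M : Set (KMW ℚ) := {x | ∃ a ∈ filtration p, ∃ b ∈ filtration p, x = a + P * b}
  have hadd {x y} (hx : x ∈ M) (hy : y ∈ M) : x + y ∈ M := by
    obtain ⟨a, ha, b, hb, rfl⟩ := hx
    obtain ⟨a', ha', b', hb', rfl⟩ := hy
    exact ⟨a + a', Subring.add_mem _ ha ha', b + b', Subring.add_mem _ hb hb', by
      rw [mul_add]; abel⟩
  have hneg {x} (hx : x ∈ M) : -x ∈ M := by
    obtain ⟨a, ha, b, hb, rfl⟩ := hx
    exact ⟨-a, Subring.neg_mem _ ha, -b, Subring.neg_mem _ hb, by rw [mul_neg]; abel⟩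
  have hleft {x y} (hx : x ∈ filtration p) (hy : y ∈ M) : x * y ∈ M := by
    obtain ⟨a, ha, b, hb, rfl⟩ := hy
    obtain ⟨x', hx', -, h⟩ := exists_swap (primeUnit p) hx
    exact ⟨x * a, Subring.mul_mem _ hx ha, x' * b, Subring.mul_mem _ hx' hb, by
      rw [mul_add, ← mul_assoc x, h, mul_assoc]⟩
  have hP {y} (hy : y ∈ M) : P * y ∈ M := by
    obtain ⟨a, ha, b, hb, rfl⟩ := hy
    exact ⟨0, Subring.zero_mem _, a + sym (-1) * b, Subring.add_mem _ ha
      (Subring.mul_mem _ (sym_neg_one_mem_filtration p) hb), by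
        rw [mul_add, ← mul_assoc P P, sym_mul_self, mul_add, zero_add, mul_assoc]⟩
  -- `M` is stable under left multiplication by `L_{p+1}`, and contains `1`.
  suffices h : ∀ y ∈ M, x * y ∈ M by
    have := h 1 ⟨1, Subring.one_mem _, 0, Subring.zero_mem _, by simp⟩
    rwa [mul_one] at this
  induction hx using Subring.closure_induction with
  | mem x hx =>
    intro y hy
    rcases hx with (rfl | rfl) | ⟨q, u, hq, hN, hu, rfl⟩
    · exact hleft (eta_mem_filtration p) hy
    · exact hleft (sym_neg_one_mem_filtration p) hy
    · rcases (Nat.lt_succ_iff.mp hN).lt_or_eq with h | rfl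
      · exact hleft (sym_prime_mem_filtration hq h hu) hy
      · have : u = primeUnit q := Units.ext hu
        exact this ▸ hP hy
  | zero => intro y hy; rw [zero_mul]; exact ⟨0, Subring.zero_mem _, 0, Subring.zero_mem _, by simp⟩
  | one => intro y hy; rwa [one_mul]
  | add x y _ _ hx hy => intro z hz; rw [add_mul]; exact hadd (hx z hz) (hy z hz)
  | neg x _ hx => intro z hz; rw [neg_mul]; exact hneg (hx z hz)
  | mul x y _ _ hx hy => intro z hz; rw [mul_assoc]; exact hx _ (hy z hz)

variable (p) in
/-- The two-sided ideal `{a | [p] a ∈ L_p}` of `L_p`. It is the kernel of the specialization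
`L_p → K^MW_*(𝔽_p)`. -/
noncomputable def divIdeal : Ideal (filtration p) where
  carrier := {a | sym (primeUnit p) * (a : KMW ℚ) ∈ filtration p}
  zero_mem' := by simp
  add_mem' {a b} ha hb := by
    change sym (primeUnit p) * ((a : KMW ℚ) + b) ∈ filtration p
    rw [mul_add]
    exact Subring.add_mem _ ha hb
  smul_mem' c a ha := by
    obtain ⟨c', hc', h, -⟩ := exists_swap (primeUnit p) c.2
    change sym (primeUnit p) * ((c : KMW ℚ) * a) ∈ filtration p
    rw [← mul_assoc, h, mul_assoc]
    exact Subring.mul_mem _ hc' ha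

theorem mem_divIdeal {a : filtration p} :
    a ∈ divIdeal p ↔ sym (primeUnit p) * (a : KMW ℚ) ∈ filtration p := Iff.rfl

instance : (divIdeal p).IsTwoSided := ⟨fun {a} b ha => by
  rw [mem_divIdeal] at ha ⊢
  rw [Subring.coe_mul, ← mul_assoc]
  exact Subring.mul_mem _ ha b.2⟩

/-- If `a = b + p c` and `[a]`, `[b]`, `[c]` lie in `L_p`, then `[a]` and `[b]` agree modulo the ideal.
This is the Steinberg relation for `p c / a + b / a = 1`. -/
theorem mk_sym_eq {a b c : ℚˣ} (ha : a ∈ filtrationUnits p) (hb : b ∈ filtrationUnits p)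
    (hc : c ∈ filtrationUnits p) (h : (a : ℚ) = b + p * c) :
    Ideal.Quotient.mk (divIdeal p) ⟨sym a, ha⟩ = Ideal.Quotient.mk (divIdeal p) ⟨sym b, hb⟩ := by
  -- `p x + y = 1` for `x = c / a` and `y = b / a`
  set x := c * a⁻¹ with hxdef
  set y := b * a⁻¹ with hydef
  have hx : x ∈ filtrationUnits p := Subgroup.mul_mem _ hc (Subgroup.inv_mem _ ha)
  have hy : y ∈ filtrationUnits p := Subgroup.mul_mem _ hb (Subgroup.inv_mem _ ha)
  have h1 : ((primeUnit p * x : ℚˣ) : ℚ) + y = 1 := by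
    have ha0 : (a : ℚ) ≠ 0 := a.ne_zero
    simp only [hxdef, hydef, Units.val_mul, Units.val_inv_eq_inv_val, primeUnit, Units.val_mk0]
    field_simp
    rw [h]; ring
  have hax : angle x ∈ filtration p := Subring.add_mem _ (Subring.one_mem _)
    (Subring.mul_mem _ (eta_mem_filtration p) hx)
  have h2 : sym (primeUnit p) * sym y ∈ filtration p := by
    have h3 := steinberg _ _ h1
    rw [mul_comm (primeUnit p) x, sym_mul, add_mul] at h3
    have h4 : sym (primeUnit p) * sym y = -(angle x * (sym x * sym y)) := by
      have := congrArg (fun z => angle x * z) h3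
      simp only [mul_add, mul_zero] at this
      rw [mul_assoc (angle x), ← mul_assoc (angle x) (angle x), ← angle_mul, angle_sq, one_mul]
        at this
      exact (neg_eq_of_add_eq_zero_right this).symm
    rw [h4]
    exact Subring.neg_mem _ (Subring.mul_mem _ hax (Subring.mul_mem _ hx hy))
  rw [eq_comm, Ideal.Quotient.mk_eq_mk_iff_sub_mem, mem_divIdeal]
  change sym (primeUnit p) * (sym b - sym a) ∈ filtration p
  have hb' : b = a * y := by rw [hydef, mul_comm b, mul_inv_cancel_left]
  have haa : angle a ∈ filtration p := Subring.add_mem _ (Subring.one_mem _)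
    (Subring.mul_mem _ (eta_mem_filtration p) ha)
  rw [hb', sym_mul, add_sub_cancel_left, ← mul_assoc, ← angle_comm, mul_assoc]
  exact Subring.mul_mem _ haa h2

/-- The representative of a unit of `𝔽_p` in `{1, …, p - 1}`. -/
def liftUnit (u : (ZMod p)ˣ) : ℚˣ :=
  Units.mk0 ((u : ZMod p).val : ℚ) (by
    rw [Nat.cast_ne_zero, Ne, ZMod.val_eq_zero]
    exact u.ne_zero)

theorem liftUnit_mem (u : (ZMod p)ˣ) : liftUnit u ∈ filtrationUnits p :=
  natCast_mem_filtrationUnits (ZMod.val_lt _) rfl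

theorem val_ne_zero (u : (ZMod p)ˣ) : (u : ZMod p).val ≠ 0 := by
  rw [Ne, ZMod.val_eq_zero]
  exact u.ne_zero

theorem res_liftUnit (π : Uniformizer p) (u : (ZMod p)ˣ) : (unitPart π).res (liftUnit u) = u := by
  refine Units.ext ?_
  rw [(unitPart_unit π (liftUnit u)
    (padicValRat_natCast_of_lt (val_ne_zero u) (ZMod.val_lt _))).2]
  rw [liftUnit, Units.val_mk0, Rat.cast_natCast, ZMod.natCast_zmod_val]

theorem liftUnit_eq_of_natCast {m : ℕ} (hm : m < p) {v : (ZMod p)ˣ}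
    (hv : (v : ZMod p) = m) : (liftUnit v : ℚ) = m := by
  simp [liftUnit, hv, ZMod.val_cast_of_lt hm]

/-- The class of the symbol of the representative of a unit of `𝔽_p`. -/
noncomputable def liftSym (u : (ZMod p)ˣ) : filtration p ⧸ divIdeal p :=
  Ideal.Quotient.mk _ ⟨sym (liftUnit u), liftUnit_mem u⟩

/-- The case of `mk_sym_eq` in which `c` is a natural number below `p`, possibly zero. -/
theorem mk_sym_eq' {a b : ℚˣ} (ha : a ∈ filtrationUnits p) (hb : b ∈ filtrationUnits p)
    {m : ℕ} (hm : m < p) (h : (a : ℚ) = b + p * m) :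
    Ideal.Quotient.mk (divIdeal p) ⟨sym a, ha⟩ = Ideal.Quotient.mk (divIdeal p) ⟨sym b, hb⟩ := by
  by_cases hm0 : m = 0
  · have : a = b := Units.ext (by simp [h, hm0])
    subst this
    rfl
  · have hm1 : (m : ℚ) ≠ 0 := by exact_mod_cast hm0
    exact mk_sym_eq ha hb (c := Units.mk0 _ hm1) (natCast_mem_filtrationUnits hm rfl) h

theorem liftSym_mul (u v : (ZMod p)ˣ) : liftSym (u * v) = liftSym u + liftSym v
    + Ideal.Quotient.mk (divIdeal p) ⟨eta, eta_mem_filtration p⟩ * liftSym u * liftSym v := by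
  have hm : liftUnit u * liftUnit v ∈ filtrationUnits p :=
    Subgroup.mul_mem _ (liftUnit_mem u) (liftUnit_mem v)
  have hlt : (u : ZMod p).val * (v : ZMod p).val / p < p := by
    rw [Nat.div_lt_iff_lt_mul hp.out.pos]
    exact Nat.mul_lt_mul'' (ZMod.val_lt _) (ZMod.val_lt _)
  have h : ((liftUnit u * liftUnit v : ℚˣ) : ℚ) = liftUnit (u * v)
      + p * ((u : ZMod p).val * (v : ZMod p).val / p : ℕ) := by
    simp only [liftUnit, Units.val_mul, Units.val_mk0, ZMod.val_mul]
    exact_mod_cast (Nat.mod_add_div _ p).symm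
  rw [liftSym, ← mk_sym_eq' hm (liftUnit_mem _) hlt h]
  change _ = Ideal.Quotient.mk (divIdeal p) (_ + _ + _ * _ * _)
  congr 1
  exact Subtype.ext (sym_mul' _ _)

theorem liftSym_neg_one : liftSym (-1 : (ZMod p)ˣ)
    = Ideal.Quotient.mk (divIdeal p) ⟨sym (-1), sym_neg_one_mem_filtration p⟩ := by
  refine mk_sym_eq' (m := 1) (liftUnit_mem _) (sym_neg_one_mem_filtration p) hp.out.one_lt ?_
  rw [liftUnit_eq_of_natCast (m := p - 1) (Nat.sub_lt hp.out.pos one_pos)]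
  · simp [Nat.cast_sub hp.out.one_le]; ring
  · simp [Nat.cast_sub hp.out.one_le]

theorem liftSym_steinberg (u v : (ZMod p)ˣ) (h : (u : ZMod p) + v = 1) :
    liftSym u * liftSym v = 0 := by
  -- The representatives `a` and `b` satisfy `a + b = p + 1`, so `[b] ≡ [1 - a]`.
  have hu := ZMod.val_lt (u : ZMod p)
  have hv := ZMod.val_lt (v : ZMod p)
  have hu0 := val_ne_zero u
  have hv0 := val_ne_zero v
  have hsum : (u : ZMod p).val + (v : ZMod p).val = p + 1 := by
    have h1 : (((u : ZMod p).val + (v : ZMod p).val : ℕ) : ZMod p) = (1 : ℕ) := by simp [h]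
    rw [ZMod.natCast_eq_natCast_iff'] at h1
    rw [Nat.mod_eq_of_lt hp.out.one_lt] at h1
    have h2 := Nat.mod_add_div ((u : ZMod p).val + (v : ZMod p).val) p
    rw [h1] at h2
    have h3 : ((u : ZMod p).val + (v : ZMod p).val) / p = 1 := by
      generalize ((u : ZMod p).val + (v : ZMod p).val) / p = c at h2
      have : c ≠ 0 := by rintro rfl; omega
      have : c < 2 := by
        by_contra hc
        have : p * 2 ≤ p * c := Nat.mul_le_mul_left p (by omega)
        omega
      omega
    rw [h3] at h2
    omega
  have hq : ((u : ZMod p).val : ℚ) + ((v : ZMod p).val : ℚ) = p + 1 := by exact_mod_cast hsum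
  have hu1 : (((u : ZMod p).val - 1 : ℕ) : ℚ) ≠ 0 := by
    rw [Nat.cast_ne_zero]; omega
  have hw : -1 * Units.mk0 _ hu1 ∈ filtrationUnits p :=
    Subgroup.mul_mem _ (sym_neg_one_mem_filtration p) (natCast_mem_filtrationUnits (by omega) rfl)
  have hwv : ((-1 * Units.mk0 _ hu1 : ℚˣ) : ℚ) = 1 - (u : ZMod p).val := by
    simp [Nat.cast_sub (Nat.one_le_iff_ne_zero.mpr hu0)]
  have h1 : liftSym v = Ideal.Quotient.mk (divIdeal p) ⟨sym (-1 * Units.mk0 _ hu1), hw⟩ := by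
    refine mk_sym_eq' (m := 1) (liftUnit_mem _) hw hp.out.one_lt ?_
    rw [hwv]
    simp only [liftUnit, Units.val_mk0]
    push_cast
    linarith
  rw [h1, liftSym, ← map_mul]
  have h2 : sym (liftUnit u) * sym (-1 * Units.mk0 _ hu1) = 0 := steinberg _ _ (by
    rw [hwv]; simp [liftUnit])
  have h3 : (⟨sym (liftUnit u), liftUnit_mem u⟩ * ⟨sym (-1 * Units.mk0 _ hu1), hw⟩
    : filtration p) = 0 := Subtype.ext h2
  rw [h3, map_zero]

variable (p) in
/-- The ring homomorphism `K^MW_*(𝔽_p) → L_p / {a | [p] a ∈ L_p}` which is inverse to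
specialization. -/
noncomputable def liftHom : KMW (ZMod p) →+* filtration p ⧸ divIdeal p :=
  lift (Ideal.Quotient.mk _ ⟨eta, eta_mem_filtration p⟩) liftSym liftSym_steinberg liftSym_mul
    (fun a => by
      rw [liftSym, ← map_mul, ← map_mul]
      exact congrArg _ (Subtype.ext (eta_sym _)))
    (by
      rw [liftSym_neg_one]
      have h : (2 + (⟨eta, eta_mem_filtration p⟩ : filtration p)
        * ⟨sym (-1), sym_neg_one_mem_filtration p⟩) * ⟨eta, eta_mem_filtration p⟩ = 0 :=
        Subtype.ext eta_rel
      rw [← map_mul, ← map_ofNat (Ideal.Quotient.mk (divIdeal p)), ← map_add, ← map_mul, h,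
        map_zero])

theorem liftHom_specialize (π : Uniformizer p) {x : KMW ℚ} (hx : x ∈ filtration p) :
    liftHom p (specialize (unitPart π) x) = Ideal.Quotient.mk (divIdeal p) ⟨x, hx⟩ := by
  induction hx using Subring.closure_induction with
  | mem x hx =>
    rcases hx with (rfl | rfl) | ⟨q, u, hq, hN, hu, rfl⟩
    · rw [specialize_eta, liftHom, lift_eta]
    · rw [specialize_sym, (unitPart π).res_neg_one, liftHom, lift_sym, liftSym_neg_one]
    · have h0 : padicValRat p (u : ℚ) = 0 := by
        rw [hu]; exact padicValRat_natCast_of_lt hq.ne_zero hN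
      have h1 : liftUnit ((unitPart π).res u) = u := Units.ext (by
        rw [liftUnit_eq_of_natCast hN, hu]
        rw [(unitPart_unit π u h0).2, hu]; simp)
      rw [specialize_sym, liftHom, lift_sym, liftSym]
      simp only [h1]
  | zero => rw [map_zero, map_zero]; exact (map_zero _).symm
  | one => rw [map_one, map_one]; exact (map_one _).symm
  | add x y _ _ hx hy => rw [map_add, map_add, hx, hy]; exact (map_add _ _ _).symm
  | neg x _ hx => rw [map_neg, map_neg, hx]; exact (map_neg _ _).symm
  | mul x y _ _ hx hy => rw [map_mul, map_mul, hx, hy]; exact (map_mul _ _ _).symm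

theorem angle_mul_angle_mul {F : Type*} [Field F] (u : Fˣ) (x : KMW F) :
    angle u * (angle u * x) = x := by
  rw [← mul_assoc, ← angle_mul, angle_sq, one_mul]

/-- The residue of `[p] b` is the specialization of `b`, up to the unit `p / π`. -/
theorem residueMap_sym_primeUnit_mul (π : Uniformizer p) {b : KMW ℚ} (hb : b ∈ filtration p) :
    residueMap (unitPart π) (sym (primeUnit p) * b)
      = angle ((unitPart π).res (primeUnit p)) * specialize (unitPart π) b := by
  rw [residueMap_mul, mem_unramified.mp (filtration_le_unramified π le_rfl hb), mul_zero, add_zero,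
    residueMap_sym_primeUnit]

/-- The residue at `p` is injective on `L_{p+1} / L_p`. -/
theorem mem_filtration_of_residueMap_eq_zero (π : Uniformizer p) {x : KMW ℚ}
    (hx : x ∈ filtration (p + 1)) (h : residueMap (unitPart π) x = 0) : x ∈ filtration p := by
  obtain ⟨a, ha, b, hb, rfl⟩ := exists_of_mem_filtration_succ p hx
  rw [map_add, mem_unramified.mp (filtration_le_unramified π le_rfl ha), zero_add,
    residueMap_sym_primeUnit_mul π hb] at h
  have h1 : specialize (unitPart π) b = 0 := by
    rw [← angle_mul_angle_mul ((unitPart π).res (primeUnit p)) (specialize (unitPart π) b), h,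
      mul_zero]
  have h2 := liftHom_specialize π hb
  rw [h1, map_zero, eq_comm, Ideal.Quotient.eq_zero_iff_mem, mem_divIdeal] at h2
  exact Subring.add_mem _ ha h2

/-- Specialization maps the degree `m` part of `L_p` onto `K^MW_m(𝔽_p)`. -/
theorem exists_specialize_eq (π : Uniformizer p) {m : ℤ} {y : KMW (ZMod p)}
    (hy : y ∈ piece (ZMod p) m) :
    ∃ x ∈ filtration p, x ∈ piece ℚ m ∧ specialize (unitPart π) x = y := by
  refine piece_induction
    (P := fun y => ∃ x ∈ filtration p, x ∈ piece ℚ m ∧ specialize (unitPart π) x = y) hy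
    (fun l hl => ?_) ⟨0, Subring.zero_mem _, zero_mem _, map_zero _⟩ ?_ ?_
  · clear hy
    subst hl
    induction l with
    | nil => exact ⟨1, Subring.one_mem _, one_mem, map_one _⟩
    | cons g l ih =>
      obtain ⟨x, h₁, h₂, h₃⟩ := ih
      obtain ⟨z, h₄, h₅, h₆⟩ : ∃ z ∈ filtration p, z ∈ piece ℚ g.degree ∧
          specialize (unitPart π) z = gen g := by
        cases g with
        | eta => exact ⟨eta, eta_mem_filtration p, eta_mem, specialize_eta _⟩
        | sym u => exact ⟨sym (liftUnit u), liftUnit_mem u, sym_mem _, by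
            rw [specialize_sym, res_liftUnit]; rfl⟩
      refine ⟨z * x, Subring.mul_mem _ h₄ h₁, ?_, ?_⟩
      · rw [List.map_cons, List.sum_cons]
        exact mul_mem h₅ h₂
      · rw [List.map_cons, List.prod_cons, map_mul, h₃, h₆]
  · rintro y z ⟨a, h₁, h₂, h₃⟩ ⟨b, h₄, h₅, h₆⟩
    exact ⟨a + b, Subring.add_mem _ h₁ h₄, add_mem h₂ h₅, by rw [map_add, h₃, h₆]⟩
  · rintro y ⟨a, h₁, h₂, h₃⟩
    exact ⟨-a, Subring.neg_mem _ h₁, neg_mem h₂, by rw [map_neg, h₃]⟩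

/-- The residue at `p` maps the degree `n` part of `L_{p+1}` onto `K^MW_{n-1}(𝔽_p)`. -/
theorem exists_residueMap_eq (π : Uniformizer p) {n : ℤ} {y : KMW (ZMod p)}
    (hy : y ∈ piece (ZMod p) (n - 1)) :
    ∃ x ∈ filtration (p + 1), x ∈ piece ℚ n ∧ residueMap (unitPart π) x = y := by
  have h := mul_mem (angle_mem ((unitPart π).res (primeUnit p))) hy
  rw [zero_add] at h
  obtain ⟨b, h₁, h₂, h₃⟩ := exists_specialize_eq π h
  refine ⟨sym (primeUnit p) * b, Subring.mul_mem _
    (sym_prime_mem_filtration hp.out p.lt_succ_self rfl) (filtration_mono p.le_succ h₁), ?_, ?_⟩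
  · have := mul_mem (sym_mem (primeUnit p)) h₂
    rwa [add_sub_cancel] at this
  · rw [residueMap_sym_primeUnit_mul π h₁, h₃, angle_mul_angle_mul]

end Filtration

/-! ### The unramified part -/

section Unramified

/-- The ring homomorphism `K^MW_*(ℚ) → ℤ` which sends `η` to `t`, and `[u]` to `s` if `u < 0` and
to `0` otherwise. It is the signature, normalized by the choice of `s` and `t`. -/
noncomputable def signature (s t : ℤ) (h : s * t = -2) : KMW ℚ →+* ℤ :=
  lift t (fun u => if (u : ℚ) < 0 then s else 0)
    (fun a b hab => by
      by_cases ha : (a : ℚ) < 0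
      · have hb : ¬ (b : ℚ) < 0 := by linarith
        simp [hb]
      · simp [ha])
    (fun a b => by
      have ht : t * s * s = -2 * s := by rw [mul_comm t, h]
      rcases lt_or_gt_of_ne a.ne_zero with ha | ha <;> rcases lt_or_gt_of_ne b.ne_zero with hb | hb
      · have hab : ¬ (a * b : ℚ) < 0 := (mul_pos_of_neg_of_neg ha hb).not_gt
        simp only [Units.val_mul, ha, hb, hab, if_true, if_false, ht]
        ring
      · simp [ha, hb.not_gt, mul_neg_of_neg_of_pos ha hb]
      · simp [ha.not_gt, hb, mul_neg_of_pos_of_neg ha hb]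
      · simp [ha.not_gt, hb.not_gt, (mul_pos ha hb).not_gt])
    (fun a => mul_comm _ _)
    (by simp [mul_comm t s, h])

theorem signature_eta (s t : ℤ) (h : s * t = -2) : signature s t h eta = t := lift_eta

theorem signature_sym (s t : ℤ) (h : s * t = -2) (u : ℚˣ) :
    signature s t h (sym u) = if (u : ℚ) < 0 then s else 0 := lift_sym u

theorem signature_neg_one (s t : ℤ) (h : s * t = -2) : signature s t h (sym (-1)) = s := by
  simp [signature_sym]

variable {F : Type*} [Field F]

theorem sq_eta_sym_neg_one : (eta * sym (-1 : Fˣ)) * (eta * sym (-1)) = -2 * (eta * sym (-1)) := by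
  have h := eta_rel (F := F)
  rw [add_mul] at h
  rw [← mul_assoc, eq_neg_of_add_eq_zero_right h, neg_mul, neg_mul, mul_assoc]

theorem eta_sym_neg_one_comm (x : KMW F) :
    (eta * sym (-1)) * x = x * (eta * sym (-1)) := by
  rw [eta_mul_sym, sub_mul, mul_sub, angle_comm, one_mul, mul_one]

variable (F) in
/-- The element `[-1]^n` for `n ≥ 0` and `η^(-n)` for `n ≤ 0`. -/
noncomputable def base (n : ℤ) : KMW F := sym (-1) ^ n.toNat * eta ^ (-n).toNat

theorem base_zero : base F 0 = 1 := by simp [base]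

theorem base_natCast (n : ℕ) : base F n = sym (-1) ^ n := by simp [base]

theorem base_neg_natCast (n : ℕ) : base F (-n) = eta ^ n := by simp [base]

theorem base_mem (n : ℤ) : base F n ∈ piece F n := by
  have h1 (m : ℕ) : (sym (-1 : Fˣ)) ^ m ∈ piece F m := by
    induction m with
    | zero => simpa using one_mem
    | succ m ih =>
      rw [pow_succ, Nat.cast_succ]
      exact mul_mem ih (sym_mem _)
  have h2 (m : ℕ) : (eta : KMW F) ^ m ∈ piece F (-m) := by
    induction m with
    | zero => simpa using one_mem
    | succ m ih =>
      rw [pow_succ, Nat.cast_succ, neg_add]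
      exact mul_mem ih eta_mem
  obtain ⟨m, rfl | rfl⟩ := n.eq_nat_or_neg
  · rw [base_natCast]; exact h1 m
  · rw [base_neg_natCast]; exact h2 m

variable (F) in
/-- The degree `n` part of the subring generated by `η` and `[-1]`: the multiples of `base F n` by
elements `a + b η[-1]`. Such elements suffice because `(η[-1])² = -2 η[-1]`. -/
noncomputable def basePiece (n : ℤ) : AddSubgroup (KMW F) where
  carrier := {x | ∃ a b : ℤ, x = ((a : KMW F) + (b : KMW F) * (eta * sym (-1))) * base F n}
  zero_mem' := ⟨0, 0, by simp⟩
  add_mem' := by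
    rintro _ _ ⟨a, b, rfl⟩ ⟨c, d, rfl⟩
    exact ⟨a + c, b + d, by push_cast; noncomm_ring⟩
  neg_mem' := by
    rintro _ ⟨a, b, rfl⟩
    exact ⟨-a, -b, by push_cast; noncomm_ring⟩

theorem coeff_mul_coeff (a b c d : ℤ) :
    ((a : KMW F) + (b : KMW F) * (eta * sym (-1)))
        * ((c : KMW F) + (d : KMW F) * (eta * sym (-1)))
      = ((a * c : ℤ) : KMW F) + ((a * d + b * c - 2 * b * d : ℤ) : KMW F) * (eta * sym (-1)) := by
  have h := sq_eta_sym_neg_one (F := F)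
  generalize eta * sym (-1 : Fˣ) = z at *
  have h1 : (b : KMW F) * z * ((d : KMW F) * z) = ((b * d : ℤ) : KMW F) * (z * z) := by
    rw [mul_assoc, ← mul_assoc z, ← (Int.cast_commute d z).eq, Int.cast_mul]; noncomm_ring
  rw [add_mul, mul_add, mul_add, h1, h, mul_assoc (b : KMW F) z, ← (Int.cast_commute c z).eq]
  push_cast
  noncomm_ring

theorem coeff_mul_mem {n : ℤ} (a b : ℤ) {x : KMW F} (hx : x ∈ basePiece F n) :
    ((a : KMW F) + (b : KMW F) * (eta * sym (-1))) * x ∈ basePiece F n := by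
  obtain ⟨c, d, rfl⟩ := hx
  exact ⟨_, _, by rw [← mul_assoc, coeff_mul_coeff]⟩

theorem base_mem_basePiece (n : ℤ) : base F n ∈ basePiece F n := ⟨1, 0, by simp⟩

theorem eta_sym_neg_one_mul_mem {n : ℤ} {x : KMW F} (hx : x ∈ basePiece F n) :
    eta * sym (-1) * x ∈ basePiece F n := by
  simpa using coeff_mul_mem 0 1 hx

theorem mul_coeff_eq {y : KMW F} (a b : ℤ) :
    y * ((a : KMW F) + (b : KMW F) * (eta * sym (-1)))
      = ((a : KMW F) + (b : KMW F) * (eta * sym (-1))) * y := by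
  rw [mul_add, add_mul, (Int.cast_commute a y).eq, ← mul_assoc, ← (Int.cast_commute b y).eq,
    mul_assoc, ← eta_sym_neg_one_comm, mul_assoc (b : KMW F)]

theorem eta_mul_mem {n : ℤ} {x : KMW F} (hx : x ∈ basePiece F n) :
    eta * x ∈ basePiece F (n - 1) := by
  have h : eta * base F n ∈ basePiece F (n - 1) := by
    rcases lt_or_ge 0 n with h | h
    · obtain ⟨m, rfl⟩ : ∃ m : ℕ, n = (m + 1 : ℕ) := ⟨(n - 1).toNat, by omega⟩
      rw [base_natCast, pow_succ', ← mul_assoc, ← base_natCast]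
      rw [show ((m + 1 : ℕ) : ℤ) - 1 = m by push_cast; ring]
      exact eta_sym_neg_one_mul_mem (base_mem_basePiece _)
    · obtain ⟨m, rfl⟩ : ∃ m : ℕ, n = -m := ⟨(-n).toNat, by omega⟩
      rw [base_neg_natCast, ← pow_succ', ← base_neg_natCast]
      rw [show (-(m : ℤ) - 1) = -((m + 1 : ℕ) : ℤ) by push_cast; ring]
      exact base_mem_basePiece _
  obtain ⟨a, b, rfl⟩ := hx
  rw [← mul_assoc, mul_coeff_eq, mul_assoc]
  exact coeff_mul_mem a b h

theorem sym_neg_one_mul_mem {n : ℤ} {x : KMW F} (hx : x ∈ basePiece F n) :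
    sym (-1) * x ∈ basePiece F (n + 1) := by
  have h : sym (-1) * base F n ∈ basePiece F (n + 1) := by
    rcases lt_or_ge n 0 with h | h
    · obtain ⟨m, rfl⟩ : ∃ m : ℕ, n = -(m + 1 : ℕ) := ⟨(-n - 1).toNat, by omega⟩
      rw [base_neg_natCast, pow_succ', ← mul_assoc, ← base_neg_natCast, ← eta_sym]
      rw [show -((m + 1 : ℕ) : ℤ) + 1 = -m by push_cast; ring]
      exact eta_sym_neg_one_mul_mem (base_mem_basePiece _)
    · obtain ⟨m, rfl⟩ : ∃ m : ℕ, n = m := ⟨n.toNat, by omega⟩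
      rw [base_natCast, ← pow_succ', ← base_natCast, Nat.cast_succ]
      exact base_mem_basePiece _
  obtain ⟨a, b, rfl⟩ := hx
  rw [← mul_assoc, mul_coeff_eq, mul_assoc]
  exact coeff_mul_mem a b h

/-- The components of an element of `L_0` lie in the groups `basePiece`. -/
theorem grade_apply_mem_basePiece {x : KMW ℚ} (hx : x ∈ filtration 0) (n : ℤ) :
    (grade ℚ x).coeff n ∈ basePiece ℚ n := by
  suffices h : ∀ y : AddMonoidAlgebra (KMW ℚ) ℤ, (∀ n, y.coeff n ∈ basePiece ℚ n) →
      ∀ n, (grade ℚ x * y).coeff n ∈ basePiece ℚ n by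
    have := h 1 (fun n => ?_) n
    · rwa [mul_one] at this
    · rw [AddMonoidAlgebra.one_def, AddMonoidAlgebra.coeff_single, Finsupp.single_apply]
      split_ifs with h
      · subst h; rw [← base_zero]; exact base_mem_basePiece 0
      · exact zero_mem _
  induction hx using Subring.closure_induction with
  | mem x hx =>
    intro y hy n
    rcases hx with (rfl | rfl) | ⟨q, u, hq, hN, hu, rfl⟩
    · have h : grade ℚ eta = AddMonoidAlgebra.single (-1) eta := grade_gen .eta
      rw [h]
      have := eta_mul_mem (hy (n + 1))
      rw [add_sub_cancel_right] at this
      rwa [AddMonoidAlgebra.coeff_single_mul_eq_mul_coeff (n + 1) (fun m _ => by omega)]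
    · have h : grade ℚ (sym (-1)) = AddMonoidAlgebra.single 1 (sym (-1)) := grade_gen (.sym _)
      rw [h]
      have := sym_neg_one_mul_mem (hy (n - 1))
      rw [sub_add_cancel] at this
      rwa [AddMonoidAlgebra.coeff_single_mul_eq_mul_coeff (n - 1) (fun m _ => by omega)]
    · exact absurd hN q.not_lt_zero
  | zero => intro y hy n; rw [map_zero, zero_mul]; exact zero_mem _
  | one => intro y hy n; rw [map_one, one_mul]; exact hy n
  | add x y _ _ hx hy =>
    intro z hz n; rw [map_add, add_mul]; exact add_mem (hx z hz n) (hy z hz n)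
  | neg x _ hx => intro z hz n; rw [map_neg, neg_mul]; exact neg_mem (hx z hz n)
  | mul x y _ _ hx hy => intro z hz; rw [map_mul, mul_assoc]; exact hx _ (hy z hz)

theorem mem_basePiece_of_mem_filtration_zero {n : ℤ} {x : KMW ℚ} (hx : x ∈ filtration 0)
    (hn : x ∈ piece ℚ n) : x ∈ basePiece ℚ n := by
  have h := grade_apply_mem_basePiece hx n
  rwa [grade_of_mem hn, AddMonoidAlgebra.coeff_single, Finsupp.single_eq_same] at h

theorem base_mem_filtration (n : ℤ) (N : ℕ) : base ℚ n ∈ filtration N :=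
  Subring.mul_mem _ (Subring.pow_mem _ (sym_neg_one_mem_filtration N) _)
    (Subring.pow_mem _ (eta_mem_filtration N) _)

theorem eta_sym_neg_one_mul_base {n : ℤ} (hn : n ≠ 0) :
    eta * sym (-1) * base F n = -2 * base F n := by
  rcases lt_or_gt_of_ne hn with h | h
  · obtain ⟨m, rfl⟩ : ∃ m : ℕ, n = -(m + 1 : ℕ) := ⟨(-n - 1).toNat, by omega⟩
    have h := eta_rel (F := F)
    rw [add_mul] at h
    rw [base_neg_natCast, pow_succ', ← mul_assoc, eq_neg_of_add_eq_zero_right h, neg_mul, neg_mul,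
      mul_assoc]
  · obtain ⟨m, rfl⟩ : ∃ m : ℕ, n = (m + 1 : ℕ) := ⟨(n - 1).toNat, by omega⟩
    have h : eta * sym (-1 : Fˣ) * sym (-1) = -2 * sym (-1) := by
      rw [eta_mul_sym, sub_mul, angle_neg_one_sym, neg_mul, two_mul, one_mul]; abel
    rw [base_natCast, pow_succ', ← mul_assoc, h, mul_assoc]

end Unramified

/-! ### The decomposition of `K^MW_n(ℚ)` -/

section Exactness

variable (π : ∀ p : Nat.Primes, Uniformizer p)

/-- The joint kernel of the residues is the subring generated by `η` and `[-1]`. -/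
theorem mem_filtration_zero {x : KMW ℚ}
    (h : ∀ p : Nat.Primes, residueMap (unitPart (π p)) x = 0) : x ∈ filtration 0 := by
  obtain ⟨N, hN⟩ := exists_mem_filtration x
  induction N with
  | zero => exact hN
  | succ N ih =>
    by_cases hp : N.Prime
    · have : Fact N.Prime := ⟨hp⟩
      exact ih (mem_filtration_of_residueMap_eq_zero (π ⟨N, hp⟩) hN (h ⟨N, hp⟩))
    · exact ih (filtration_succ_of_not_prime hp ▸ hN)

theorem coe_residue {p : ℕ} [Fact p.Prime] (π : Uniformizer p) (n : ℤ) (x : piece ℚ n) :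
    (residue π n x : KMW (ZMod p)) = residueMap (unitPart π) x := rfl

theorem residue_eq_zero_of_mem {p : ℕ} [Fact p.Prime] (π : Uniformizer p) {n : ℤ} {N : ℕ}
    {x : piece ℚ n} (hx : (x : KMW ℚ) ∈ filtration N) (h : N ≤ p) : residue π n x = 0 :=
  Subtype.ext (filtration_le_unramified π h hx)

/-- Every family of residues which vanishes for almost all primes is attained. -/
theorem exists_residue_eq {n : ℤ} (N : ℕ) (f : ∀ p : Nat.Primes, piece (ZMod p) (n - 1))
    (hf : ∀ p : Nat.Primes, N ≤ p → f p = 0) : ∃ x : piece ℚ n, ∀ p, residue (π p) n x = f p := by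
  induction N generalizing f with
  | zero => exact ⟨0, fun p => by rw [map_zero, hf p (Nat.zero_le _)]⟩
  | succ N ih =>
    by_cases hN : N.Prime
    · let q : Nat.Primes := ⟨N, hN⟩
      have : Fact N.Prime := ⟨hN⟩
      obtain ⟨z, h₁, h₂, h₃⟩ := exists_residueMap_eq (π q) (f q).2
      obtain ⟨x, hx⟩ := ih (fun p => f p - residue (π p) n ⟨z, h₂⟩) (fun p hp => by
        rcases hp.lt_or_eq with hlt | heq
        · rw [hf p hlt, zero_sub, neg_eq_zero]
          exact residue_eq_zero_of_mem (π p) h₁ hlt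
        · obtain rfl : q = p := Subtype.ext heq
          exact sub_eq_zero.mpr (Subtype.ext h₃.symm))
      exact ⟨x + ⟨z, h₂⟩, fun p => by rw [map_add, hx, sub_add_cancel]⟩
    · refine ih f fun p hp => hf p ?_
      rcases hp.lt_or_eq with hlt | heq
      · exact hlt
      · exact absurd (heq ▸ p.2) hN

theorem exists_directSum_residue {n : ℤ} (x : piece ℚ n) :
    ∃ f : ⨁ p : Nat.Primes, piece (ZMod p) (n - 1), ∀ p, f p = residue (π p) n x := by
  obtain ⟨N, hN⟩ := exists_mem_filtration (x : KMW ℚ)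
  let s : Finset Nat.Primes := Finset.subtype _ (Finset.range N)
  refine ⟨DirectSum.mk _ s fun p => residue (π p) n x, fun p => ?_⟩
  by_cases hp : p ∈ s
  · exact DirectSum.mk_apply_of_mem hp
  · rw [DirectSum.mk_apply_of_notMem hp]
    have : N ≤ p := by
      by_contra h
      exact hp (Finset.mem_subtype.mpr (Finset.mem_range.mpr (not_le.mp h)))
    exact (residue_eq_zero_of_mem (π p) hN this).symm

/-- The total residue homomorphism. -/
noncomputable def totalResidue (n : ℤ) :
    piece ℚ n →+ ⨁ p : Nat.Primes, piece (ZMod p) (n - 1) where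
  toFun x := (exists_directSum_residue π x).choose
  map_zero' := by
    ext p : 1
    rw [(exists_directSum_residue π 0).choose_spec p, map_zero, DirectSum.zero_apply]
  map_add' x y := by
    ext p : 1
    rw [DirectSum.add_apply, (exists_directSum_residue π _).choose_spec p,
      (exists_directSum_residue π _).choose_spec p, (exists_directSum_residue π _).choose_spec p,
      map_add]

theorem totalResidue_apply {n : ℤ} (x : piece ℚ n) (p : Nat.Primes) :
    totalResidue π n x p = residue (π p) n x := (exists_directSum_residue π x).choose_spec p

/-- A homomorphism which is bijective on the unramified elements of degree `n` gives, together with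
the residues, a decomposition of `K^MW_n(ℚ)`. -/
theorem exists_equiv_of_unramified {A : Type*} [AddCommGroup A] {n : ℤ} (σ : piece ℚ n →+ A)
    (hinj : ∀ x : piece ℚ n, (x : KMW ℚ) ∈ basePiece ℚ n → σ x = 0 → x = 0)
    (hsurj : ∀ a, ∃ x : piece ℚ n, (x : KMW ℚ) ∈ filtration 0 ∧ σ x = a) :
    ∃ e : piece ℚ n ≃+ A × ⨁ p : Nat.Primes, piece (ZMod p) (n - 1),
      ∀ x p, (e x).2 p = residue (π p) n x := by
  refine ⟨AddEquiv.ofBijective (σ.prod (totalResidue π n)) ⟨?_, ?_⟩,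
    fun x p => totalResidue_apply π x p⟩
  · rw [injective_iff_map_eq_zero]
    intro x hx
    have h₁ : σ x = 0 := congrArg Prod.fst hx
    have h₂ : totalResidue π n x = 0 := congrArg Prod.snd hx
    refine hinj x (mem_basePiece_of_mem_filtration_zero (mem_filtration_zero π fun p => ?_) x.2) h₁
    rw [← coe_residue, ← totalResidue_apply, h₂]
    rfl
  · rintro ⟨a, f⟩
    obtain ⟨N, hN⟩ : ∃ N : ℕ, ∀ p : Nat.Primes, N ≤ p → f p = 0 := by
      classical
      refine ⟨(DFinsupp.support f).sup (fun p => (p : ℕ)) + 1, fun p hp => ?_⟩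
      by_contra h
      have := Finset.le_sup (f := fun p : Nat.Primes => (p : ℕ)) (DFinsupp.mem_support_iff.mpr h)
      simp only at this
      omega
    obtain ⟨x, hx⟩ := exists_residue_eq π N (fun p => f p) hN
    obtain ⟨y, hy, hy'⟩ := hsurj (a - σ x)
    refine ⟨y + x, Prod.ext ?_ ?_⟩
    · change σ (y + x) = a
      rw [map_add, hy', sub_add_cancel]
    · change totalResidue π n (y + x) = f
      ext p : 1
      rw [totalResidue_apply, map_add, hx, residue_eq_zero_of_mem (π p) hy (Nat.zero_le _),
        zero_add]

theorem exists_equiv_of_ne_zero {n : ℤ} (hn : n ≠ 0) :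
    ∃ e : piece ℚ n ≃+ ℤ × ⨁ p : Nat.Primes, piece (ZMod p) (n - 1),
      ∀ x p, (e x).2 p = residue (π p) n x := by
  -- The normalization is chosen so that the signature of `base n` is a unit.
  obtain ⟨s, t, h, hst⟩ : ∃ (s t : ℤ) (h : s * t = -2),
      IsUnit (signature s t h (base ℚ n)) := by
    rcases lt_or_gt_of_ne hn with h | h
    · obtain ⟨m, rfl⟩ : ∃ m : ℕ, n = -m := ⟨(-n).toNat, by omega⟩
      exact ⟨-2, 1, by norm_num, by rw [base_neg_natCast, map_pow, signature_eta]; simp⟩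
    · obtain ⟨m, rfl⟩ : ∃ m : ℕ, n = m := ⟨n.toNat, by omega⟩
      exact ⟨-1, 2, by norm_num, by
        rw [base_natCast, map_pow, signature_neg_one]; exact IsUnit.pow _ (by simp)⟩
  refine exists_equiv_of_unramified π
    ((signature s t h).toAddMonoidHom.comp (piece ℚ n).subtype) (fun x hx h0 => ?_) (fun a => ?_)
  · obtain ⟨a, b, hab⟩ := hx
    have h1 : (x : KMW ℚ) = ((a - 2 * b : ℤ) : KMW ℚ) * base ℚ n := by
      rw [hab, add_mul, mul_assoc (b : KMW ℚ), eta_sym_neg_one_mul_base hn]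
      push_cast
      rw [sub_mul, neg_mul, mul_neg, ← mul_assoc, ← (Int.cast_commute b (2 : KMW ℚ)).eq]
      rw [sub_eq_add_neg]
    have h2 : signature s t h x = 0 := h0
    rw [h1, map_mul, map_intCast, Int.cast_id, mul_eq_zero, or_iff_left hst.ne_zero] at h2
    rw [h2, Int.cast_zero, zero_mul] at h1
    exact Subtype.ext h1
  · obtain ⟨u, hu⟩ := hst
    refine ⟨(a * (u⁻¹ : ℤˣ) : ℤ) • ⟨base ℚ n, base_mem n⟩, ?_, ?_⟩
    · exact zsmul_mem (base_mem_filtration n 0) _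
    · rw [map_zsmul]
      change _ • signature s t h (base ℚ n) = a
      rw [← hu, smul_eq_mul, mul_assoc, Units.inv_mul, mul_one]

/-- In degree `0`, rank and signature have the same parity. -/
theorem two_dvd_rank_sub_signature {x : KMW ℚ} (hx : x ∈ piece ℚ 0) :
    2 ∣ rank ℚ x - signature (-2) 1 (by norm_num) x := by
  refine piece_induction (P := fun x => 2 ∣ rank ℚ x - signature (-2) 1 (by norm_num) x) hx
    (fun l hl => ?_) (by simp) (fun x y hx hy => ?_) (fun x hx => ?_)
  · rcases l with _ | ⟨g, l⟩
    · simp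
    · have h1 : rank ℚ ((g :: l).map gen).prod = 0 := by
        rw [List.map_cons, List.prod_cons, map_mul, rank_gen, zero_mul]
      obtain ⟨u, hu⟩ : ∃ u, Gen.sym u ∈ g :: l := by
        by_contra! hne
        have h2 : ∀ d ∈ (g :: l).map Gen.degree, d ≤ -1 := by
          intro d hd
          obtain ⟨g', hg', rfl⟩ := List.mem_map.mp hd
          cases g' with
          | eta => exact le_rfl
          | sym u => exact absurd hg' (hne u)
        have h3 := List.sum_le_card_nsmul _ _ h2
        rw [hl] at h3
        simp at h3
        omega
      have h2 : signature (-2) 1 (by norm_num) (sym u) ∣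
          signature (-2) 1 (by norm_num) ((g :: l).map gen).prod := by
        rw [map_list_prod]
        exact List.dvd_prod (List.mem_map_of_mem (List.mem_map_of_mem hu))
      have h3 : 2 ∣ signature (-2) 1 (by norm_num) (sym u) := by
        rw [signature_sym]; split_ifs <;> norm_num
      rw [h1, zero_sub, dvd_neg]
      exact h3.trans h2
  · rw [map_add, map_add, add_sub_add_comm]
    exact dvd_add hx hy
  · rw [map_neg, map_neg, ← neg_sub', dvd_neg]
    exact hx

/-- Half the difference of rank and signature, in degree `0`. The normalization of the signature
makes it the usual one there: `⟨u⟩ ↦ ±1`. -/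
noncomputable def negativeIndex : piece ℚ 0 →+ ℤ where
  toFun x := (rank ℚ x - signature (-2) 1 (by norm_num) x) / 2
  map_zero' := by simp
  map_add' x y := by
    rw [AddSubgroup.coe_add, map_add, map_add, add_sub_add_comm,
      Int.add_ediv_of_dvd_left (two_dvd_rank_sub_signature x.2)]

theorem exists_equiv_zero :
    ∃ e : piece ℚ 0 ≃+ (ℤ × ℤ) × ⨁ p : Nat.Primes, piece (ZMod p) (0 - 1),
      ∀ x p, (e x).2 p = residue (π p) 0 x := by
  have hval (a b : ℤ) : rank ℚ (((a : KMW ℚ) + (b : KMW ℚ) * (eta * sym (-1))) * base ℚ 0) = a ∧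
      signature (-2) 1 (by norm_num)
        (((a : KMW ℚ) + (b : KMW ℚ) * (eta * sym (-1))) * base ℚ 0) = a - 2 * b := by
    simp [base_zero, signature_eta, signature_neg_one]
    ring
  have hmem (a b : ℤ) :
      (((a : KMW ℚ) + (b : KMW ℚ) * (eta * sym (-1))) * base ℚ 0) ∈ piece ℚ 0 := by
    rw [base_zero, mul_one, ← zsmul_one, ← zsmul_eq_mul]
    exact add_mem (zsmul_mem one_mem _) (zsmul_mem (mul_mem eta_mem (sym_mem _)) _)
  refine exists_equiv_of_unramified π
    (((rank ℚ).toAddMonoidHom.comp (piece ℚ 0).subtype).prod negativeIndex)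
    (fun x hx h0 => ?_) (fun c => ?_)
  · obtain ⟨a, b, hab⟩ := hx
    have h1 : rank ℚ x = 0 := congrArg Prod.fst h0
    have h2 : (rank ℚ x - signature (-2) 1 (by norm_num) x) / 2 = 0 := congrArg Prod.snd h0
    rw [hab, (hval a b).1] at h1
    rw [hab, (hval a b).1, (hval a b).2] at h2
    have hb : b = 0 := by omega
    refine Subtype.ext ?_
    rw [hab, h1, hb]
    simp
  · refine ⟨⟨((c.1 : KMW ℚ) + (c.2 : KMW ℚ) * (eta * sym (-1))) * base ℚ 0, hmem c.1 c.2⟩, ?_, ?_⟩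
    · exact Subring.mul_mem _ (Subring.add_mem _ (intCast_mem _ _) (Subring.mul_mem _
        (intCast_mem _ _) (Subring.mul_mem _ (eta_mem_filtration 0)
          (sym_neg_one_mem_filtration 0)))) (base_mem_filtration 0 0)
    · refine Prod.ext (hval c.1 c.2).1 ?_
      change (rank ℚ _ - signature (-2) 1 (by norm_num) _) / 2 = c.2
      rw [(hval c.1 c.2).1, (hval c.1 c.2).2]
      omega

end Exactness

/-! ### Milnor-Witt K-theory of `𝔽_p` -/

section PrimeField

theorem zmod_two_units_eq_one (u : (ZMod 2)ˣ) : u = 1 := by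
  revert u
  decide

variable {p : ℕ} [hp : Fact p.Prime]

/-- Every binary form `u x² + v y²` over `𝔽_p` represents `1`. -/
theorem exists_mul_sq_add_mul_sq (u v : (ZMod p)ˣ) :
    ∃ x y : ZMod p, u * x ^ 2 + v * y ^ 2 = 1 := by
  rcases hp.out.eq_two_or_odd with rfl | hodd
  · exact ⟨1, 0, by rw [zmod_two_units_eq_one u]; simp⟩
  · have hu := u.ne_zero
    have hv := v.ne_zero
    obtain ⟨x, y, h⟩ := FiniteField.exists_root_sum_quadratic
      (f := Polynomial.C (u : ZMod p) * Polynomial.X ^ 2)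
      (g := Polynomial.C (v : ZMod p) * Polynomial.X ^ 2 + Polynomial.C 0 * Polynomial.X
        + Polynomial.C (-1))
      (Polynomial.degree_C_mul_X_pow 2 hu) (Polynomial.degree_quadratic hv)
      (by rw [ZMod.card]; exact hodd)
    refine ⟨x, y, ?_⟩
    simp at h
    linear_combination h

theorem hyp_mul_sym_mul_sym {F : Type*} [Field F] (a : Fˣ) :
    (1 + angle (-1)) * (sym a * sym a) = 0 := by
  rw [sym_mul_self, sym_neg_one_comm, ← mul_assoc, hyp_sym, zero_mul]

theorem sym_mul_self_eq {F : Type*} [Field F] (a : Fˣ) :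
    sym (a * a) = (1 + angle (-1)) * sym a := by
  rw [sym_mul', mul_assoc eta, sym_mul_self, sym_neg_one_comm, ← mul_assoc, eta_mul_sym]
  noncomm_ring

/-- Products of two symbols vanish over `𝔽_p`. -/
theorem sym_mul_sym_eq_zero (a b : (ZMod p)ˣ) : sym a * sym b = 0 := by
  obtain ⟨g, hg⟩ := IsCyclic.exists_generator (α := (ZMod p)ˣ)
  have top (H : Subgroup (ZMod p)ˣ) (h : g ∈ H) (u : (ZMod p)ˣ) : u ∈ H :=
    (Subgroup.zpowers_le.mpr h) (hg u)
  -- Annihilators of elements are subgroups of the units, so it is enough to show `[g][g] = 0`.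
  suffices h : sym g * sym g = 0 by
    have h1 : ∀ u, sym g * sym u = 0 := top (symAnnihilator (sym g)) h
    have h2 : sym a * sym g = 0 := by rw [sym_mul_sym_comm, h1, mul_zero]
    exact top (symAnnihilator (sym a)) h2 b
  have h1 : ∀ u, (1 + angle (-1)) * sym g * sym u = 0 :=
    top (symAnnihilator ((1 + angle (-1)) * sym g))
      (by rw [mem_symAnnihilator, mul_assoc, hyp_mul_sym_mul_sym])
  have hcomm (x : KMW (ZMod p)) : (1 + angle (-1)) * x = x * (1 + angle (-1)) := by
    rw [add_mul, mul_add, angle_comm, one_mul, mul_one]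
  have h2 : ∀ u v : (ZMod p)ˣ, (1 + angle (-1)) * sym v * sym u = 0 := by
    intro u v
    have h3 : (1 + angle (-1)) * sym v * sym g = 0 := by
      rw [mul_assoc, sym_mul_sym_comm, ← mul_assoc, hcomm, mul_assoc, ← mul_assoc _ (sym g),
        h1, mul_zero]
    exact top (symAnnihilator ((1 + angle (-1)) * sym v)) h3 u
  have h3 : ∀ u v : (ZMod p)ˣ, sym u * sym (v * v) = 0 := by
    intro u v
    rw [sym_mul_self_eq, ← mul_assoc, ← hcomm, h2]
  have h4 : ∀ u v : (ZMod p)ˣ, sym (v * v) * sym u = 0 := by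
    intro u v
    rw [sym_mul_self_eq, h2]
  by_cases hsq : ∃ c, g = c * c
  · obtain ⟨c, hc⟩ := hsq
    nth_rw 2 [hc]
    exact h3 g c
  -- For a nonsquare `g` there is a Steinberg relation between `g x²` and `g y²`.
  obtain ⟨x, y, hxy⟩ := exists_mul_sq_add_mul_sq g g
  have hne (x y : ZMod p) (hxy : (g : ZMod p) * x ^ 2 + g * y ^ 2 = 1) : x ≠ 0 := by
    rintro rfl
    have hy : y ≠ 0 := by rintro rfl; simp at hxy
    refine hsq ⟨(Units.mk0 y hy)⁻¹, ?_⟩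
    rw [eq_mul_inv_iff_mul_eq, eq_inv_iff_mul_eq_one]
    refine Units.ext ?_
    simp only [Units.val_mul, Units.val_mk0, Units.val_one]
    linear_combination hxy
  have hx := hne x y hxy
  have hy := hne y x (by rw [add_comm]; exact hxy)
  have h5 : sym (g * (Units.mk0 x hx * Units.mk0 x hx))
      * sym (g * (Units.mk0 y hy * Units.mk0 y hy)) = 0 := steinberg _ _ (by
    simp only [Units.val_mul, Units.val_mk0]
    linear_combination hxy)
  rwa [sym_mul g, sym_mul g, add_mul, mul_add, mul_add, mul_assoc (angle g), h4,
    ← mul_assoc (sym g), ← angle_comm, mul_assoc (angle g) (sym g), h3,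
    mul_assoc (angle g) (sym _), ← mul_assoc (sym _) (angle g), ← angle_comm,
    mul_assoc (angle g) (sym _), h3, mul_zero, mul_zero, add_zero, add_zero, add_zero] at h5

/-- As `η` is central, products of generators can be written with all factors `η` in front. -/
theorem exists_list_prod_eq {F : Type*} [Field F] (l : List (Gen F)) :
    ∃ (i : ℕ) (us : List Fˣ), (l.map gen).prod = eta ^ i * (us.map sym).prod ∧
      (l.map Gen.degree).sum = us.length - i := by
  induction l with
  | nil => exact ⟨0, [], by simp, by simp⟩
  | cons g l ih =>
    obtain ⟨i, us, h₁, h₂⟩ := ih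
    rw [List.map_cons, List.prod_cons, List.map_cons, List.sum_cons, h₁, h₂]
    cases g with
    | eta => exact ⟨i + 1, us, by rw [pow_succ', mul_assoc]; rfl, by simp [Gen.degree]; ring⟩
    | sym u =>
      refine ⟨i, u :: us, ?_, by simp [Gen.degree]; ring⟩
      have h : Commute (eta ^ i) (gen (Gen.sym u)) :=
        Commute.pow_left (eta_comm _ : Commute eta (gen (Gen.sym u))) i
      rw [List.map_cons, List.prod_cons, ← mul_assoc, ← h.eq, mul_assoc]
      rfl

theorem list_sym_prod_eq_zero (us : List (ZMod p)ˣ) (h : 2 ≤ us.length) :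
    (us.map sym).prod = 0 := by
  rcases us with _ | ⟨a, _ | ⟨b, us⟩⟩
  · simp at h
  · simp at h
  · rw [List.map_cons, List.map_cons, List.prod_cons, List.prod_cons, ← mul_assoc,
      sym_mul_sym_eq_zero, zero_mul]

theorem sym_mul_eq_add (a b : (ZMod p)ˣ) : sym (a * b) = sym a + sym b := by
  rw [sym_mul', mul_assoc, sym_mul_sym_eq_zero, mul_zero, add_zero]

theorem sym_inv_eq_neg (a : (ZMod p)ˣ) : sym a⁻¹ = -sym a := by
  rw [eq_neg_iff_add_eq_zero, ← sym_mul_eq_add, inv_mul_cancel, sym_one]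

/-- `K^MW_n(𝔽_p)` vanishes for `n ≥ 2`. -/
theorem eq_zero_of_mem_piece {n : ℤ} (hn : 2 ≤ n) {x : KMW (ZMod p)} (hx : x ∈ piece (ZMod p) n) :
    x = 0 := by
  refine piece_induction (P := fun x => x = 0) hx (fun l hl => ?_) rfl
    (fun x y hx hy => by rw [hx, hy, add_zero]) (fun x hx => by rw [hx, neg_zero])
  obtain ⟨i, us, h₁, h₂⟩ := exists_list_prod_eq l
  rw [h₁, list_sym_prod_eq_zero us (by omega), mul_zero]

/-- Every element of `K^MW_1(𝔽_p)` is a symbol. -/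
theorem exists_eq_sym {x : KMW (ZMod p)} (hx : x ∈ piece (ZMod p) 1) : ∃ u, x = sym u := by
  refine piece_induction (P := fun x => ∃ u, x = sym u) hx (fun l hl => ?_) ⟨1, sym_one.symm⟩ ?_ ?_
  · obtain ⟨i, us, h₁, h₂⟩ := exists_list_prod_eq l
    rcases us with _ | ⟨a, _ | ⟨b, us⟩⟩
    · simp at h₂; omega
    · obtain rfl : i = 0 := by simp at h₂; omega
      exact ⟨a, by simpa using h₁⟩
    · exact ⟨1, by rw [h₁, list_sym_prod_eq_zero _ (by simp), mul_zero, sym_one]⟩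
  · rintro x y ⟨u, rfl⟩ ⟨v, rfl⟩
    exact ⟨u * v, (sym_mul_eq_add u v).symm⟩
  · rintro x ⟨u, rfl⟩
    exact ⟨u⁻¹, (sym_inv_eq_neg u).symm⟩

/-- Every element of `K^MW_0(𝔽_p)` has the form `m + η[u]`. -/
theorem exists_eq_int_add_eta_mul_sym {x : KMW (ZMod p)} (hx : x ∈ piece (ZMod p) 0) :
    ∃ (m : ℤ) (u : (ZMod p)ˣ), x = (m : KMW (ZMod p)) + eta * sym u := by
  refine piece_induction
    (P := fun x => ∃ (m : ℤ) (u : (ZMod p)ˣ), x = (m : KMW (ZMod p)) + eta * sym u) hx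
    (fun l hl => ?_) ⟨0, 1, by simp [sym_one]⟩ ?_ ?_
  · obtain ⟨i, us, h₁, h₂⟩ := exists_list_prod_eq l
    rcases us with _ | ⟨a, _ | ⟨b, us⟩⟩
    · obtain rfl : i = 0 := by simp at h₂; omega
      exact ⟨1, 1, by simp [h₁, sym_one]⟩
    · obtain rfl : i = 1 := by simp at h₂; omega
      exact ⟨0, a, by simpa using h₁⟩
    · exact ⟨0, 1, by rw [h₁, list_sym_prod_eq_zero _ (by simp)]; simp [sym_one]⟩
  · rintro x y ⟨m, u, rfl⟩ ⟨n, v, rfl⟩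
    exact ⟨m + n, u * v, by rw [sym_mul_eq_add]; push_cast; noncomm_ring⟩
  · rintro x ⟨m, u, rfl⟩
    exact ⟨-m, u⁻¹, by rw [sym_inv_eq_neg]; push_cast; noncomm_ring⟩

/-- The endomorphism `(n, v) ↦ (0, uⁿ)` of `ℤ ⊕ Fˣ`. -/
noncomputable def unitEnd {F : Type*} [Field F] (u : Fˣ) : AddMonoid.End (ℤ × Additive Fˣ) :=
  (AddMonoidHom.inr ℤ (Additive Fˣ)).comp
    ((zmultiplesHom (Additive Fˣ) (Additive.ofMul u)).comp (AddMonoidHom.fst ℤ (Additive Fˣ)))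

theorem unitEnd_apply {F : Type*} [Field F] (u : Fˣ) (x : ℤ × Additive Fˣ) :
    unitEnd u x = (0, x.1 • Additive.ofMul u) := rfl

/-- The action of `K^MW_*(F)` on `ℤ ⊕ Fˣ` through its quotient by `η` and by products of
two symbols. -/
noncomputable def unitsAction (F : Type*) [Field F] :
    KMW F →+* AddMonoid.End (ℤ × Additive Fˣ) :=
  lift (F := F) 0 unitEnd
    (fun a b _ => AddMonoidHom.ext fun x => by
      change unitEnd a (unitEnd b x) = (0, 0)
      rw [unitEnd_apply, unitEnd_apply, zero_smul])
    (fun a b => by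
      refine AddMonoidHom.ext fun x => ?_
      change unitEnd (a * b) x = unitEnd a x + unitEnd b x + 0
      rw [add_zero, unitEnd_apply, unitEnd_apply, unitEnd_apply, ofMul_mul, zsmul_add,
        Prod.mk_add_mk, add_zero])
    (fun a => by rw [zero_mul, mul_zero]) (by rw [mul_zero])

theorem unitsAction_sym {F : Type*} [Field F] (u : Fˣ) :
    (unitsAction F (sym u) (1, 0)).2 = Additive.ofMul u := by
  have h : unitsAction F (sym u) = unitEnd u := lift_sym u
  rw [h, unitEnd_apply, one_smul]

variable (p) in
theorem exists_equiv_units (m : ℤ) (hm : m = 1) :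
    ∃ φ : piece (ZMod p) m ≃+ Additive (ZMod p)ˣ,
      ∀ (u : (ZMod p)ˣ) (x : piece (ZMod p) m), (x : KMW (ZMod p)) = sym u →
        φ x = Additive.ofMul u := by
  subst hm
  let f : piece (ZMod p) 1 →+ Additive (ZMod p)ˣ :=
    { toFun := fun x => (unitsAction (ZMod p) x (1, 0)).2
      map_zero' := by simp
      map_add' := fun x y => by
        rw [AddSubgroup.coe_add, map_add]; rfl }
  have hf (u : (ZMod p)ˣ) (x : piece (ZMod p) 1) (hx : (x : KMW (ZMod p)) = sym u) :
      f x = Additive.ofMul u := by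
    change (unitsAction (ZMod p) x (1, 0)).2 = _
    rw [hx, unitsAction_sym]
  refine ⟨AddEquiv.ofBijective f ⟨?_, fun u => ⟨⟨sym u.toMul, sym_mem _⟩, hf _ _ rfl⟩⟩, hf⟩
  rw [injective_iff_map_eq_zero]
  intro x hx
  obtain ⟨u, hu⟩ := exists_eq_sym x.2
  rw [hf u x hu] at hx
  have : u = 1 := hx
  exact Subtype.ext (by rw [hu, this, sym_one]; rfl)

/-- An element `t` with `t² = 2t = 0` gives a ring homomorphism with `η ↦ 1` which sends `[u]` to
`0` or `t` according to whether `u` is a square, provided that `2 + [-1]` maps to `0`. -/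
theorem exists_hom_of_element {R : Type*} [CommRing R] (t : R) (h₁ : t * t = 0) (h₂ : t + t = 0)
    (h₃ : 2 + (if IsSquare (-1 : (ZMod p)ˣ) then 0 else t) = 0) :
    ∃ f : KMW (ZMod p) →+* R, f eta = 1 ∧ ∀ u, f (sym u) = if IsSquare u then 0 else t := by
  classical
  refine ⟨lift 1 (fun u => if IsSquare u then 0 else t) (fun a b _ => ?_) (fun a b => ?_)
    (fun a => mul_comm _ _) (by rw [one_mul, mul_one]; convert h₃), lift_eta, fun u => ?_⟩
  · split_ifs <;> simp [h₁]
  · obtain ⟨g, hg⟩ := IsCyclic.exists_generator (α := (ZMod p)ˣ)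
    by_cases ha : IsSquare a <;> by_cases hb : IsSquare b
    · simp [ha, hb, ha.mul hb]
    · have : ¬ IsSquare (a * b) := fun h => hb (by simpa using ha.inv.mul h)
      simp [ha, hb, this]
    · have : ¬ IsSquare (a * b) := fun h => ha (by simpa using h.mul hb.inv)
      simp [ha, hb, this]
    · -- both are odd powers of a generator
      have odd {c : (ZMod p)ˣ} (hc : ¬ IsSquare c) : ∃ i : ℤ, c = g ^ (2 * i + 1) := by
        obtain ⟨k, rfl⟩ := Subgroup.mem_zpowers_iff.mp (hg c)
        rcases Int.even_or_odd' k with ⟨i, rfl | rfl⟩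
        · exact absurd ⟨g ^ i, by rw [← zpow_add, two_mul]⟩ hc
        · exact ⟨i, rfl⟩
      obtain ⟨i, hi⟩ := odd ha
      obtain ⟨j, hj⟩ := odd hb
      have : IsSquare (a * b) := ⟨g ^ (i + j + 1), by
        rw [hi, hj, ← zpow_add, ← zpow_add]; congr 1; ring⟩
      simp [ha, hb, this, h₁, h₂]
  · rw [lift_sym]

/-- If `η[u] = 0` in `K^MW_0(𝔽_p)`, then `u` is a square. -/
theorem isSquare_of_eta_mul_sym_eq_zero {u : (ZMod p)ˣ} (h : eta * sym u = 0) : IsSquare u := by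
  classical
  by_contra hu
  have key {R : Type} [CommRing R] (t : R) (h₀ : t ≠ 0) (h₁ : t * t = 0) (h₂ : t + t = 0)
      (h₃ : 2 + (if IsSquare (-1 : (ZMod p)ˣ) then 0 else t) = 0) : False := by
    obtain ⟨f, hf, hf'⟩ := exists_hom_of_element t h₁ h₂ (by convert h₃)
    have h4 := congrArg f h
    rw [map_mul, hf, hf', if_neg hu, one_mul, map_zero] at h4
    exact h₀ h4
  -- The target is the dual numbers over `𝔽_2` or `ℤ/4`, just as for the Witt ring of `𝔽_p`.
  by_cases hm : IsSquare (-1 : (ZMod p)ˣ)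
  · refine key (R := TrivSqZeroExt (ZMod 2) (ZMod 2)) (TrivSqZeroExt.inr 1) ?_ ?_ ?_ ?_
    · intro h
      exact one_ne_zero (α := ZMod 2) (congrArg TrivSqZeroExt.snd h)
    · exact TrivSqZeroExt.inr_mul_inr _ _ _
    · exact TrivSqZeroExt.ext (by simp) (by simp; decide)
    · have h2 : (1 + 1 : TrivSqZeroExt (ZMod 2) (ZMod 2)) = 0 :=
        TrivSqZeroExt.ext (by simp; decide) (by simp)
      rw [if_pos hm, add_zero]
      exact one_add_one_eq_two.symm.trans h2
  · exact key (R := ZMod 4) 2 (by decide) (by decide) (by decide) (by rw [if_neg hm]; decide)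

end PrimeField

end KMW

/-! ### Symmetric bilinear forms and the Grothendieck-Witt group -/

section Forms

variable {k : Type*} [Field k]

/-- A nondegenerate symmetric bilinear form on a finite dimensional space, in coordinates. -/
noncomputable def SymForm.ofBilin {V : Type*} [AddCommGroup V] [Module k V] [FiniteDimensional k V]
    (B : LinearMap.BilinForm k V) (hs : B.IsSymm) (hn : B.Nondegenerate) : SymForm k where
  rank := Module.finrank k V
  form := LinearMap.BilinForm.congr (Module.finBasis k V).equivFun B
  symm := ⟨fun _ _ => hs.eq _ _⟩
  nondegenerate := hn.congr _

/-- The coordinates used in `SymForm.ofBilin`. -/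
noncomputable def SymForm.coords {V : Type*} [AddCommGroup V] [Module k V] [FiniteDimensional k V]
    (B : LinearMap.BilinForm k V) (hs : B.IsSymm) (hn : B.Nondegenerate) :
    V ≃ₗ[k] (Fin (SymForm.ofBilin B hs hn).rank → k) :=
  (Module.finBasis k V).equivFun

theorem SymForm.ofBilin_apply {V : Type*} [AddCommGroup V] [Module k V] [FiniteDimensional k V]
    (B : LinearMap.BilinForm k V) (hs : B.IsSymm) (hn : B.Nondegenerate) (x y : V) :
    (SymForm.ofBilin B hs hn).form (SymForm.coords B hs hn x) (SymForm.coords B hs hn y)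
      = B x y := by
  change B ((Module.finBasis k V).equivFun.symm ((Module.finBasis k V).equivFun x))
    ((Module.finBasis k V).equivFun.symm ((Module.finBasis k V).equivFun y)) = B x y
  rw [LinearEquiv.symm_apply_apply, LinearEquiv.symm_apply_apply]

theorem SymForm.IsOrthogonalSum.rank_eq {A B C : SymForm k} (h : A.IsOrthogonalSum B C) :
    C.rank = A.rank + B.rank := by
  obtain ⟨e, -⟩ := h
  simpa using e.finrank_eq.symm

theorem SymForm.exists_orthogonalSum (A B : SymForm k) :
    ∃ C : SymForm k, ∃ e : ((Fin A.rank → k) × (Fin B.rank → k)) ≃ₗ[k] (Fin C.rank → k),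
    ∀ x y, C.form (e x) (e y) = A.form x.1 y.1 + B.form x.2 y.2 := by
  let Φ : LinearMap.BilinForm k ((Fin A.rank → k) × (Fin B.rank → k)) :=
    A.form.comp (LinearMap.fst k _ _) (LinearMap.fst k _ _)
      + B.form.comp (LinearMap.snd k _ _) (LinearMap.snd k _ _)
  have hΦ (x y) : Φ x y = A.form x.1 y.1 + B.form x.2 y.2 := rfl
  have hs : Φ.IsSymm := ⟨fun x y => by rw [hΦ, hΦ, A.symm.eq, B.symm.eq]⟩
  have hn : Φ.Nondegenerate := by
    refine ⟨fun x hx => Prod.ext (A.nondegenerate.1 _ fun y => ?_)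
      (B.nondegenerate.1 _ fun y => ?_), fun x hx => Prod.ext (A.nondegenerate.2 _ fun y => ?_)
      (B.nondegenerate.2 _ fun y => ?_)⟩
    · simpa [hΦ] using hx (y, 0)
    · simpa [hΦ] using hx (0, y)
    · simpa [hΦ] using hx (y, 0)
    · simpa [hΦ] using hx (0, y)
  exact ⟨SymForm.ofBilin Φ hs hn, SymForm.coords Φ hs hn, fun x y => by
    rw [SymForm.ofBilin_apply, hΦ]⟩

/-- The coordinate on the space of a form of rank one. -/
noncomputable def SymForm.rankOneCoord (u : kˣ) : (Fin (SymForm.rankOne u).rank → k) ≃ₗ[k] k :=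
  LinearEquiv.funUnique (Fin 1) k k

theorem SymForm.rankOne_apply (u : kˣ) (x y : Fin (SymForm.rankOne u).rank → k) :
    (SymForm.rankOne u).form x y
      = u * (SymForm.rankOneCoord u x * SymForm.rankOneCoord u y) := by
  have h (x y : Fin 1 → k) : Matrix.toBilin' !![(u : k)] x y = u * (x 0 * y 0) := by
    simp [Matrix.toBilin'_apply]
    ring
  exact h x y

/-- The vector with a given coordinate in the space of a form of rank one. -/
noncomputable def SymForm.rankOneVec (u : kˣ) (c : k) : Fin (SymForm.rankOne u).rank → k :=
  (SymForm.rankOneCoord u).symm c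

theorem SymForm.rankOne_vec (u : kˣ) (c d : k) :
    (SymForm.rankOne u).form (SymForm.rankOneVec u c) (SymForm.rankOneVec u d) = u * (c * d) := by
  rw [SymForm.rankOne_apply, SymForm.rankOneVec, SymForm.rankOneVec, LinearEquiv.apply_symm_apply,
    LinearEquiv.apply_symm_apply]

/-- A vector of norm `a ≠ 0` splits off an orthogonal summand `⟨a⟩`. The complement represents the
norms of all vectors orthogonal to it. -/
theorem SymForm.exists_split (A : SymForm k) (v : Fin A.rank → k) (a : kˣ) (ha : A.form v v = a) :
    ∃ D : SymForm k, (SymForm.rankOne a).IsOrthogonalSum D A ∧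
      ∀ w, A.form v w = 0 → ∃ d, D.form d d = A.form w w := by
  have hv : A.form v v ≠ 0 := ha ▸ a.ne_zero
  have hv0 : v ≠ 0 := by rintro rfl; simp at hv
  have hrefl : A.form.IsRefl := A.symm.isRefl
  set W := A.form.orthogonal (k ∙ v)
  have hc : IsCompl (k ∙ v) W := LinearMap.BilinForm.isCompl_span_singleton_orthogonal hv
  have hs : (A.form.restrict W).IsSymm := ⟨fun x y => A.symm.eq _ _⟩
  have hn : (A.form.restrict W).Nondegenerate :=
    LinearMap.BilinForm.restrict_nondegenerate_orthogonal_spanSingleton _ A.nondegenerate hrefl hv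
  let D := SymForm.ofBilin (A.form.restrict W) hs hn
  have horth (w : W) : A.form v w = 0 := w.2 v (Submodule.mem_span_singleton_self v)
  refine ⟨D, ?_, fun w hw => ?_⟩
  · let e₁ : (Fin (SymForm.rankOne a).rank → k) ≃ₗ[k] (k ∙ v) :=
      (SymForm.rankOneCoord a).trans (LinearEquiv.toSpanNonzeroSingleton k _ v hv0)
    let e₂ : (Fin D.rank → k) ≃ₗ[k] W := (SymForm.coords _ hs hn).symm
    have he₁ (x) : (e₁ x : Fin A.rank → k) = SymForm.rankOneCoord a x • v := rfl
    have he₂ (x y : Fin D.rank → k) : A.form (e₂ x) (e₂ y) = D.form x y := rfl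
    refine ⟨(e₁.prodCongr e₂).trans (Submodule.prodEquivOfIsCompl _ _ hc), fun x y => ?_⟩
    have he (z) :
        ((e₁.prodCongr e₂).trans (Submodule.prodEquivOfIsCompl _ _ hc)) z
          = SymForm.rankOneCoord a z.1 • v + (e₂ z.2 : Fin A.rank → k) := by
      rw [← he₁]; rfl
    rw [he, he]
    have h1 : A.form (e₂ x.2) v = 0 := by rw [A.symm.eq]; exact horth _
    simp only [map_add, map_smul, LinearMap.add_apply, LinearMap.smul_apply, smul_eq_mul, horth,
      h1, he₂, ha]
    rw [SymForm.rankOne_apply]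
    ring
  · have hwW : w ∈ W := by
      intro n hn
      obtain ⟨c, rfl⟩ := Submodule.mem_span_singleton.mp hn
      change A.form (c • v) w = 0
      rw [map_smul, LinearMap.smul_apply, hw, smul_zero]
    exact ⟨SymForm.coords _ hs hn ⟨w, hwW⟩, SymForm.ofBilin_apply _ hs hn _ _⟩

/-- The class of a form in `GW(k)`. -/
noncomputable def GW.cls (A : SymForm k) : GW k := QuotientAddGroup.mk (FreeAbelianGroup.of A)

theorem GW.cls_rankOne (u : kˣ) : GW.cls (SymForm.rankOne u) = GW.rankOne u := rfl

theorem GW.cls_eq_add {A B C : SymForm k} (h : A.IsOrthogonalSum B C) :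
    GW.cls C = GW.cls A + GW.cls B := by
  refine (QuotientAddGroup.eq_iff_sub_mem).mpr (AddSubgroup.subset_closure ⟨A, B, C, h, rfl⟩)

theorem GW.cls_eq_zero {A : SymForm k} (h : A.rank = 0) : GW.cls A = 0 := by
  have : IsEmpty (Fin A.rank) := by rw [h]; infer_instance
  have h1 : A.IsOrthogonalSum A A := by
    refine ⟨LinearEquiv.ofSubsingleton _ _, fun x y => ?_⟩
    rw [Subsingleton.elim x 0, Subsingleton.elim y 0]
    simp
  exact left_eq_add.mp (GW.cls_eq_add h1)

/-- The Grothendieck-Witt group is generated by the forms of rank one, also in characteristic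
two. -/
theorem GW.cls_mem_closure (A : SymForm k) :
    GW.cls A ∈ AddSubgroup.closure (Set.range (GW.rankOne (k := k))) := by
  obtain ⟨n, hn⟩ : ∃ n, A.rank = n := ⟨_, rfl⟩
  induction n using Nat.strong_induction_on generalizing A with
  | _ n ih =>
  by_cases h0 : n = 0
  · rw [GW.cls_eq_zero (hn.trans h0)]
    exact zero_mem _
  have hmem (u : kˣ) : GW.rankOne u ∈ AddSubgroup.closure (Set.range (GW.rankOne (k := k))) :=
    AddSubgroup.subset_closure ⟨u, rfl⟩
  by_cases hA : ∃ v, A.form v v ≠ 0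
  · obtain ⟨v, hv⟩ := hA
    obtain ⟨D, hD, -⟩ := A.exists_split v (Units.mk0 _ hv) rfl
    have hr : A.rank = 1 + D.rank := hD.rank_eq
    rw [GW.cls_eq_add hD]
    exact add_mem (hmem _) (ih D.rank (by omega) D rfl)
  · -- An alternating form `A` is diagonalizable after adding `⟨1⟩`.
    push Not at hA
    obtain ⟨x, y, hxy⟩ : ∃ x y, A.form x y ≠ 0 := by
      by_contra! h
      have : NeZero A.rank := ⟨by omega⟩
      have h1 : (1 : Fin A.rank → k) = 0 := A.nondegenerate.1 _ fun y => h _ y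
      exact one_ne_zero h1
    -- If `x` and `y` are not orthogonal, then the complement of `(1, x)` contains
    -- `(-A(x, y), y)`, so that it is not alternating.
    obtain ⟨C, e, he⟩ := SymForm.exists_orthogonalSum (SymForm.rankOne (1 : kˣ)) A
    have hC : (SymForm.rankOne (1 : kˣ)).IsOrthogonalSum A C := ⟨e, he⟩
    obtain ⟨D, hD, hD'⟩ := C.exists_split (e (SymForm.rankOneVec 1 1, x)) 1 (by
      rw [he, SymForm.rankOne_vec]; simp [hA])
    obtain ⟨d, hd⟩ := hD' (e (SymForm.rankOneVec 1 (-A.form x y), y)) (by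
      rw [he, SymForm.rankOne_vec]; simp)
    rw [he, SymForm.rankOne_vec, hA] at hd
    have hd0 : D.form d d ≠ 0 := by
      rw [hd]; simpa using hxy
    obtain ⟨E, hE, -⟩ := D.exists_split d (Units.mk0 _ hd0) rfl
    have h1 : GW.cls A = GW.cls D :=
      add_left_cancel ((GW.cls_eq_add hC).symm.trans (GW.cls_eq_add hD))
    have r1 : C.rank = 1 + A.rank := hC.rank_eq
    have r2 : C.rank = 1 + D.rank := hD.rank_eq
    have r3 : D.rank = 1 + E.rank := hE.rank_eq
    rw [h1, GW.cls_eq_add hE]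
    exact add_mem (hmem _) (ih E.rank (by omega) E rfl)

theorem GW.closure_rankOne : AddSubgroup.closure (Set.range (GW.rankOne (k := k))) = ⊤ := by
  refine eq_top_iff.mpr fun x _ => ?_
  obtain ⟨y, rfl⟩ := QuotientAddGroup.mk_surjective x
  clear * -
  induction y using FreeAbelianGroup.induction_on with
  | zero => exact zero_mem _
  | of A => exact GW.cls_mem_closure A
  | neg A h => exact neg_mem h
  | add x y hx hy => exact add_mem hx hy

/-- A form of rank one is determined by any of its nonzero values. -/
theorem GW.cls_eq_rankOne {A : SymForm k} (hA : A.rank = 1) (v : Fin A.rank → k) (a : kˣ)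
    (h : A.form v v = a) : GW.cls A = GW.rankOne a := by
  obtain ⟨D, hD, -⟩ := A.exists_split v a h
  have hr : A.rank = 1 + D.rank := hD.rank_eq
  rw [GW.cls_eq_add hD, GW.cls_eq_zero (by omega : D.rank = 0), add_zero, GW.cls_rankOne]

theorem GW.rankOne_mul_self (s : kˣ) : GW.rankOne (s * s) = GW.rankOne (1 : kˣ) :=
  (GW.cls_eq_rankOne (A := SymForm.rankOne 1) rfl (SymForm.rankOneVec 1 (s : k)) (s * s) (by
    rw [SymForm.rankOne_vec]; simp)).symm

/-- A binary form `⟨u, v⟩` which represents `1` is `⟨1, uv⟩`. -/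
theorem GW.rankOne_add_rankOne {u v : kˣ} {x y : k} (h : u * x ^ 2 + v * y ^ 2 = 1) :
    GW.rankOne u + GW.rankOne v = GW.rankOne 1 + GW.rankOne (u * v) := by
  obtain ⟨C, e, he⟩ := SymForm.exists_orthogonalSum (SymForm.rankOne u) (SymForm.rankOne v)
  have hC : (SymForm.rankOne u).IsOrthogonalSum (SymForm.rankOne v) C := ⟨e, he⟩
  obtain ⟨D, hD, hD'⟩ := C.exists_split (e (SymForm.rankOneVec u x, SymForm.rankOneVec v y)) 1 (by
    rw [he, SymForm.rankOne_vec, SymForm.rankOne_vec, Units.val_one, ← h]; ring)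
  -- The vector `(-v y, u x)` is orthogonal to `(x, y)` and has norm `u v`.
  obtain ⟨d, hd⟩ := hD' (e (SymForm.rankOneVec u (-(v * y)), SymForm.rankOneVec v (u * x))) (by
    rw [he, SymForm.rankOne_vec, SymForm.rankOne_vec]; ring)
  have hd1 : D.form d d = ((u * v : kˣ) : k) := by
    rw [hd, he, SymForm.rankOne_vec, SymForm.rankOne_vec, Units.val_mul]
    linear_combination (u * v : k) * h
  have r1 : C.rank = 1 + 1 := hC.rank_eq
  have r2 : C.rank = 1 + D.rank := hD.rank_eq
  rw [← GW.cls_rankOne u, ← GW.cls_rankOne v, ← GW.cls_eq_add hC, GW.cls_eq_add hD,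
    GW.cls_eq_rankOne (by omega) d _ hd1, GW.cls_rankOne]

/-- The determinant of the Gram matrix of a form. -/
noncomputable def SymForm.disc (A : SymForm k) : kˣ :=
  Units.mk0 (LinearMap.BilinForm.toMatrix (Pi.basisFun k (Fin A.rank)) A.form).det
    ((LinearMap.BilinForm.nondegenerate_iff_det_ne_zero _).mp A.nondegenerate)

theorem SymForm.disc_rankOne (u : kˣ) : (SymForm.rankOne u).disc = u := by
  refine Units.ext ?_
  change (LinearMap.BilinForm.toMatrix (Pi.basisFun k (Fin 1))
    (Matrix.toBilin' !![(u : k)])).det = u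
  rw [Matrix.det_unique, LinearMap.BilinForm.toMatrix_apply]
  simp [Matrix.toBilin'_apply]

/-- The discriminant is multiplicative up to squares. -/
theorem SymForm.IsOrthogonalSum.exists_disc_eq {A B C : SymForm k} (h : A.IsOrthogonalSum B C) :
    ∃ c : kˣ, A.disc * B.disc = C.disc * (c * c) := by
  have hr := h.rank_eq
  obtain ⟨e, he⟩ := h
  let b := ((Pi.basisFun k (Fin A.rank)).prod (Pi.basisFun k (Fin B.rank))).map e
  let σ : Fin C.rank ≃ Fin A.rank ⊕ Fin B.rank := (finCongr hr).trans finSumFinEquiv.symm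
  let b' := (Pi.basisFun k (Fin C.rank)).reindex σ
  have h1 : (LinearMap.BilinForm.toMatrix b C.form).det = A.disc * B.disc := by
    have : LinearMap.BilinForm.toMatrix b C.form = Matrix.fromBlocks
        (LinearMap.BilinForm.toMatrix (Pi.basisFun k (Fin A.rank)) A.form) 0 0
        (LinearMap.BilinForm.toMatrix (Pi.basisFun k (Fin B.rank)) B.form) := by
      ext i j
      rcases i with i | i <;> rcases j with j | j <;>
        simp [b, LinearMap.BilinForm.toMatrix_apply, he]
    rw [this, Matrix.det_fromBlocks_zero₂₁]
    rfl
  have h2 : (LinearMap.BilinForm.toMatrix b' C.form).det = C.disc := by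
    have : LinearMap.BilinForm.toMatrix b' C.form = Matrix.reindex σ σ
        (LinearMap.BilinForm.toMatrix (Pi.basisFun k (Fin C.rank)) C.form) := by
      ext i j
      simp [b', LinearMap.BilinForm.toMatrix_apply]
    rw [this, Matrix.det_reindex_self]
    rfl
  have h3 := congrArg Matrix.det (LinearMap.BilinForm.toMatrix_mul_basis_toMatrix b' b C.form)
  rw [Matrix.det_mul, Matrix.det_mul, Matrix.det_transpose, h1, h2] at h3
  have h4 : (b'.toMatrix b).det ≠ 0 := by
    intro h0
    rw [h0, mul_zero] at h3
    exact mul_ne_zero A.disc.ne_zero B.disc.ne_zero h3.symm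
  refine ⟨Units.mk0 _ h4, Units.ext ?_⟩
  simp only [Units.val_mul, Units.val_mk0]
  rw [← h3]
  ring

end Forms

/-! ### The Grothendieck-Witt group of `𝔽_p` -/

section PrimeFieldForms

open KMW

variable {p : ℕ} [hp : Fact p.Prime]

/-- Every element of `GW(𝔽_p)` is an integral multiple of `⟨1⟩` plus a difference `⟨u⟩ - ⟨1⟩`. -/
theorem GW.exists_eq (x : GW (ZMod p)) :
    ∃ (m : ℤ) (u : (ZMod p)ˣ), x = m • GW.rankOne 1 + (GW.rankOne u - GW.rankOne 1) := by
  have hmul (u v : (ZMod p)ˣ) : GW.rankOne (u * v) - GW.rankOne 1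
      = (GW.rankOne u - GW.rankOne 1) + (GW.rankOne v - GW.rankOne 1) := by
    obtain ⟨x, y, h⟩ := exists_mul_sq_add_mul_sq u v
    rw [sub_add_sub_comm, GW.rankOne_add_rankOne h]
    abel
  have hx : x ∈ AddSubgroup.closure (Set.range (GW.rankOne (k := ZMod p))) :=
    GW.closure_rankOne (k := ZMod p) ▸ AddSubgroup.mem_top x
  induction hx using AddSubgroup.closure_induction with
  | mem x hx =>
    obtain ⟨u, rfl⟩ := hx
    exact ⟨1, u, by rw [one_smul, add_sub_cancel]⟩
  | zero => exact ⟨0, 1, by simp⟩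
  | add x y _ _ hx hy =>
    obtain ⟨m, u, rfl⟩ := hx
    obtain ⟨n, v, rfl⟩ := hy
    exact ⟨m + n, u * v, by rw [hmul, add_smul]; abel⟩
  | neg x _ hx =>
    obtain ⟨m, u, rfl⟩ := hx
    refine ⟨-m, u⁻¹, ?_⟩
    have h := hmul u u⁻¹
    rw [mul_inv_cancel, sub_self] at h
    rw [eq_neg_of_add_eq_zero_right h.symm, neg_smul, neg_add]

theorem eta_mul_sym_mul_self {F : Type*} [Field F] (c : Fˣ) : eta * sym (c * c) = 0 := by
  rw [eta_mul_sym, angle_sq, sub_self]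

/-- The element `rank + η[disc]` of `K^MW_0(𝔽_p)` attached to a form. -/
noncomputable def SymForm.toKMW (A : SymForm (ZMod p)) : piece (ZMod p) 0 :=
  ⟨(A.rank : KMW (ZMod p)) + eta * sym A.disc, by
    have h1 : (A.rank : KMW (ZMod p)) ∈ piece (ZMod p) 0 := by
      rw [← nsmul_one]
      exact nsmul_mem one_mem _
    have h2 := mul_mem eta_mem (sym_mem A.disc)
    rw [neg_add_cancel] at h2
    exact add_mem h1 h2⟩

theorem SymForm.toKMW_eq_add {A B C : SymForm (ZMod p)} (h : A.IsOrthogonalSum B C) :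
    C.toKMW = A.toKMW + B.toKMW := by
  refine Subtype.ext ?_
  obtain ⟨c, hc⟩ := h.exists_disc_eq
  have h1 := congrArg (fun u => eta * sym u) hc
  simp only [sym_mul_eq_add A.disc, sym_mul_eq_add C.disc, mul_add, eta_mul_sym_mul_self,
    add_zero] at h1
  change (C.rank : KMW (ZMod p)) + eta * sym C.disc
    = ((A.rank : KMW (ZMod p)) + eta * sym A.disc)
      + ((B.rank : KMW (ZMod p)) + eta * sym B.disc)
  rw [← h1, h.rank_eq, Nat.cast_add]
  abel

/-- The homomorphism `GW(𝔽_p) → K^MW_0(𝔽_p)` given by rank and discriminant. -/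
noncomputable def GW.toKMW : GW (ZMod p) →+ piece (ZMod p) 0 :=
  QuotientAddGroup.lift _ (FreeAbelianGroup.lift SymForm.toKMW) (by
    rw [AddSubgroup.closure_le]
    rintro _ ⟨A, B, C, h, rfl⟩
    rw [SetLike.mem_coe, AddMonoidHom.mem_ker, map_sub, map_add, FreeAbelianGroup.lift_apply_of,
      FreeAbelianGroup.lift_apply_of, FreeAbelianGroup.lift_apply_of, SymForm.toKMW_eq_add h,
      sub_self])

theorem GW.coe_toKMW_rankOne (u : (ZMod p)ˣ) :
    (GW.toKMW (GW.rankOne u) : KMW (ZMod p)) = angle u := by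
  have h : GW.toKMW (GW.rankOne u) = (SymForm.rankOne u).toKMW :=
    FreeAbelianGroup.lift_apply_of _ _
  rw [h]
  change ((1 : ℕ) : KMW (ZMod p)) + eta * sym (SymForm.rankOne u).disc = angle u
  rw [SymForm.disc_rankOne, Nat.cast_one, angle]

theorem GW.coe_toKMW (m : ℤ) (u : (ZMod p)ˣ) :
    (GW.toKMW (m • GW.rankOne 1 + (GW.rankOne u - GW.rankOne 1)) : KMW (ZMod p))
      = (m : KMW (ZMod p)) + eta * sym u := by
  rw [map_add, map_sub, map_zsmul, AddSubgroup.coe_add, AddSubgroup.coe_sub, AddSubgroup.coe_zsmul,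
    GW.coe_toKMW_rankOne, GW.coe_toKMW_rankOne, angle_one, zsmul_one, angle, add_sub_cancel_left]

theorem GW.toKMW_bijective : Function.Bijective (GW.toKMW (p := p)) := by
  constructor
  · rw [injective_iff_map_eq_zero]
    intro x hx
    obtain ⟨m, u, rfl⟩ := GW.exists_eq x
    have h := GW.coe_toKMW m u
    rw [hx, AddSubgroup.coe_zero] at h
    have h1 := congrArg (rank (ZMod p)) h
    rw [map_zero, map_add, map_mul, rank_eta, zero_mul, add_zero, map_intCast, Int.cast_id] at h1
    subst h1
    rw [Int.cast_zero, zero_add] at h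
    obtain ⟨s, rfl⟩ := isSquare_of_eta_mul_sym_eq_zero h.symm
    rw [GW.rankOne_mul_self, zero_smul, sub_self, add_zero]
  · rintro ⟨x, hx⟩
    obtain ⟨m, u, rfl⟩ := exists_eq_int_add_eta_mul_sym hx
    exact ⟨_, Subtype.ext (GW.coe_toKMW m u)⟩

variable (p) in
theorem exists_equiv_GW (m : ℤ) (hm : m = 0) :
    ∃ φ : piece (ZMod p) m ≃+ GW (ZMod p),
      ∀ (u : (ZMod p)ˣ) (x : piece (ZMod p) m), (x : KMW (ZMod p)) = angle u →
        φ x = GW.rankOne u := by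
  subst hm
  refine ⟨(AddEquiv.ofBijective _ GW.toKMW_bijective).symm, fun u x hx => ?_⟩
  rw [AddEquiv.symm_apply_eq]
  exact Subtype.ext (hx.trans (GW.coe_toKMW_rankOne u).symm)

end PrimeFieldForms

/-! ### Transport along the identifications over `𝔽_p` -/

section Assembly

open KMW

/-- Replaces the summands of a direct sum by isomorphic ones. -/
theorem exists_equiv_congr {ι A M : Type*} [AddCommGroup A] [AddCommGroup M] {B C : ι → Type*}
    [∀ i, AddCommGroup (B i)] [∀ i, AddCommGroup (C i)] (φ : ∀ i, B i ≃+ C i)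
    (e : M ≃+ A × ⨁ i, B i) :
    ∃ e' : M ≃+ A × ⨁ i, C i, ∀ x i, (e' x).2 i = φ i ((e x).2 i) :=
  ⟨e.trans ((AddEquiv.refl A).prodCongr (DFinsupp.mapRange.addEquiv φ)),
    fun _ _ => DFinsupp.mapRange_apply _ (fun i => map_zero (φ i)) _ _⟩

theorem nonempty_equiv_int {n : ℤ} (hn : 3 ≤ n) (π : ∀ p : Nat.Primes, Uniformizer p) :
    Nonempty (piece ℚ n ≃+ ℤ) := by
  obtain ⟨e, -⟩ := exists_equiv_of_ne_zero π (by omega : n ≠ 0)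
  have (p : Nat.Primes) : Subsingleton (piece (ZMod p) (n - 1)) :=
    ⟨fun x y => Subtype.ext ((eq_zero_of_mem_piece (by omega) x.2).trans
      (eq_zero_of_mem_piece (by omega) y.2).symm)⟩
  have : Subsingleton (⨁ p : Nat.Primes, piece (ZMod p) (n - 1)) :=
    ⟨fun f g => DFinsupp.ext fun p => Subsingleton.elim _ _⟩
  have : Unique (⨁ p : Nat.Primes, piece (ZMod p) (n - 1)) := Unique.mk' _
  exact ⟨e.trans AddEquiv.prodUnique⟩

end Assembly

end MilnorWitt

theorem proposition2p4 (π : ∀ p : Nat.Primes, MilnorWitt.Uniformizer p) :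
    (∀ n : ℤ, n ≠ 0 →
      ∃ e : MilnorWitt.KMW.piece ℚ n ≃+
          ℤ × ⨁ p : Nat.Primes, MilnorWitt.KMW.piece (ZMod p) (n - 1),
        ∀ x p, (e x).2 p = MilnorWitt.residue (π p) n x) ∧
    (∃ e : MilnorWitt.KMW.piece ℚ 0 ≃+
        (ℤ × ℤ) × ⨁ p : Nat.Primes, MilnorWitt.KMW.piece (ZMod p) (0 - 1),
      ∀ x p, (e x).2 p = MilnorWitt.residue (π p) 0 x) ∧
    (∃ φ : ∀ p : Nat.Primes, MilnorWitt.KMW.piece (ZMod p) (1 - 1) ≃+ MilnorWitt.GW (ZMod p),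
      (∀ (p : Nat.Primes) (u : (ZMod p)ˣ) (x : MilnorWitt.KMW.piece (ZMod p) (1 - 1)),
        (x : MilnorWitt.KMW (ZMod p)) = MilnorWitt.KMW.angle u →
          φ p x = MilnorWitt.GW.rankOne u) ∧
      ∃ e : MilnorWitt.KMW.piece ℚ 1 ≃+ ℤ × ⨁ p : Nat.Primes, MilnorWitt.GW (ZMod p),
        ∀ x p, (e x).2 p = φ p (MilnorWitt.residue (π p) 1 x)) ∧
    (∃ φ : ∀ p : Nat.Primes, MilnorWitt.KMW.piece (ZMod p) (2 - 1) ≃+ Additive (ZMod p)ˣ,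
      (∀ (p : Nat.Primes) (u : (ZMod p)ˣ) (x : MilnorWitt.KMW.piece (ZMod p) (2 - 1)),
        (x : MilnorWitt.KMW (ZMod p)) = MilnorWitt.KMW.sym u → φ p x = Additive.ofMul u) ∧
      ∃ e : MilnorWitt.KMW.piece ℚ 2 ≃+ ℤ × ⨁ p : Nat.Primes, Additive (ZMod p)ˣ,
        ∀ x p, (e x).2 p = φ p (MilnorWitt.residue (π p) 2 x)) ∧
    (∀ n : ℤ, 3 ≤ n → Nonempty (MilnorWitt.KMW.piece ℚ n ≃+ ℤ)) := by
  refine ⟨fun n hn => MilnorWitt.KMW.exists_equiv_of_ne_zero π hn,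
    MilnorWitt.KMW.exists_equiv_zero π, ?_, ?_,
    fun n hn => MilnorWitt.nonempty_equiv_int hn π⟩
  · choose φ hφ using fun p : Nat.Primes => MilnorWitt.exists_equiv_GW p (1 - 1) (sub_self 1)
    obtain ⟨e, he⟩ := MilnorWitt.KMW.exists_equiv_of_ne_zero π (one_ne_zero (α := ℤ))
    obtain ⟨e', he'⟩ := MilnorWitt.exists_equiv_congr φ e
    exact ⟨φ, hφ, e', fun x p => by rw [he', he]⟩
  · choose φ hφ using fun p : Nat.Primes =>
      MilnorWitt.KMW.exists_equiv_units p (2 - 1) (by norm_num)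
    obtain ⟨e, he⟩ := MilnorWitt.KMW.exists_equiv_of_ne_zero π (two_ne_zero (α := ℤ))
    obtain ⟨e', he'⟩ := MilnorWitt.exists_equiv_congr φ e
    exact ⟨φ, hφ, e', fun x p => by rw [he', he]⟩
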